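/- Let $d\ge 2$ be an integer, let $A,B\in\mathbb{Q}[z]$ with $B\neq 0$, and let $f(z)\in\mathbb{Q}((z^{-1}))$ be a Laurent series satisfying $$f(z)=\frac{A(z)}{B(z)}\,f(z^d).$$ Let $b\in\mathbb{Z}$ lie inside the (open) disc of convergence $\{|z|>R\}$ of $f$, and assume that $A(b^{d^m})B(b^{d^m})\neq 0$ for all integers $m\ge 0$ and that the real number $f(b)$ is irrational. Then the irrationality exponent of $f(b)$, that is, the supremum of the real numbers $\mu$ for which $\left|f(b)-\frac pq\right|<q^{-\mu}$ has infinitely many rational solutions $p/q$ (in lowest terms, $q>0$), is finite and is a rational number. -/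

import Mathlib

noncomputable section

namespace Mahler

/-- The field `ℚ((z⁻¹))`. It is the field of Laurent series in the variable `z⁻¹`: for `n : ℤ`,
`f.coeff n` is the coefficient of `z ^ (-n)`, and only finitely many positive powers of `z`
occur. -/
abbrev SeriesAtInfinity : Type := LaurentSeries ℚ

/-- A polynomial `P(z)` as an element of `ℚ((z⁻¹))`; the variable `z` is `(z⁻¹)⁻¹`. -/
def ofPoly (P : Polynomial ℚ) : SeriesAtInfinity :=
  Polynomial.aeval (HahnSeries.single (-1 : ℤ) (1 : ℚ) : SeriesAtInfinity) P

/-- Multiplication by `d ≥ 1` as an order embedding of `ℤ` into itself. -/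
def mulEmb (d : ℕ) (hd : 0 < d) : ℤ ↪o ℤ :=
  OrderEmbedding.ofStrictMono (fun n : ℤ => (d : ℤ) * n)
    (fun _ _ h => mul_lt_mul_of_pos_left h (by exact_mod_cast hd))

/-- The series `f(z ^ d)`: the coefficient of `z ^ (-n)` in `f` becomes that of `z ^ (-d n)`,
and all other coefficients are zero. -/
def substPow (d : ℕ) (hd : 0 < d) (f : SeriesAtInfinity) : SeriesAtInfinity :=
  HahnSeries.embDomain (mulEmb d hd) f

/-- The (open) disc of convergence of `f`, a disc around infinity: all `z` such that the series
converges absolutely on some circle of radius `r` with `0 < r < |z|`. -/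
def convergenceDisc (f : SeriesAtInfinity) : Set ℂ :=
  {z | ∃ r : ℝ, 0 < r ∧ r < ‖z‖ ∧ Summable fun n : ℤ => |(f.coeff n : ℝ)| * r ^ (-n)}

/-- The value `f(x)` at a real point `x` (meant for points in the disc of convergence). -/
def value (f : SeriesAtInfinity) (x : ℝ) : ℝ :=
  ∑' n : ℤ, (f.coeff n : ℝ) * x ^ (-n)

/-- The irrationality exponent of a real number `ξ`: the supremum of all real `μ` for which
`|ξ - p/q| < q ^ (-μ)` has infinitely many rational solutions `p/q` (written in lowest terms with
`q > 0`). It is an extended real number. -/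
def irrationalityExponent (ξ : ℝ) : EReal :=
  sSup ((fun μ : ℝ => (μ : EReal)) ''
    {μ : ℝ | {x : ℚ | |ξ - (x : ℝ)| < (x.den : ℝ) ^ (-μ)}.Infinite})

end Mahler

end

noncomputable section

namespace Mahler

open Filter Topology Polynomial

/-! For a reduced fraction `p / q` write `D` for the degree of `q` and `E` for the order at infinity
of `q f - p`. The exponent of `f(b)` turns out to be `1 + ρ`, where `ρ` is the limit superior of `E
/ D` as `D` grows, or `1` if that is larger; the point is that `ρ` is rational.

Function field side. The map `R ↦ (A / B) R(z ^ d)` fixes `f` and sends the order of `f - R` to `d`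
times itself plus `deg B - deg A` (`Step.errOrder_eq`). Along an orbit, the degree of the reduced
denominator is asymptotic to a rational multiple of `d ^ i`, because the cancellation at each zero
or pole of `A / B` is eventually periodic in `i` (`exists_tendsto_natDegree`). So `E / D` has a
rational limit on each orbit of large enough initial degree. Conversely, an approximation whose `E`
clearly exceeds `D` is the image of a Padé approximation of smaller degree (`IsPade.step`). By
descent, those with `E > (1 + ε) D` and large `D` lie on finitely many orbits, and `ρ` is `1` or a
maximum of finitely many rational limits (`exists_rat_exponent`).

Number side. Iterating the equation relates `f(b)` to `f(b ^ d ^ m)`, so each fixed `p / q` yields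
integers `P m`, `Q m` with `log |Q m|` close to `(D + β) d ^ m log |b|` and `log |Q m f(b) - P m|`
close to `(-E + α) d ^ m log |b|`. Here `α = deg A / (d - 1)` and `β = deg B / (d - 1)` do not
depend on `p / q`, so they become negligible for large `D`. Good fractions `p / q` give the lower
bound (`infinite_approxSet`); the Padé approximations from one finite window of degrees, taken at
all `m`, give the upper bound (`finite_approxSet`).

All this needs `|b| ≥ 2`. If `|b| = 1`, then `f` converges on a circle of radius less than `1` and
is rational (`exists_mul_eq_ofPoly_of_decays`), so `f(b)` could not be irrational. -/

/-! ### The embedding of polynomials -/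

/-- The ring homomorphism underlying `ofPoly`. -/
def polyHom : ℚ[X] →ₐ[ℚ] SeriesAtInfinity :=
  Polynomial.aeval (HahnSeries.single (-1 : ℤ) (1 : ℚ) : SeriesAtInfinity)

theorem ofPoly_mul (p q : ℚ[X]) : ofPoly (p * q) = ofPoly p * ofPoly q := map_mul polyHom p q

theorem ofPoly_add (p q : ℚ[X]) : ofPoly (p + q) = ofPoly p + ofPoly q := map_add polyHom p q

theorem ofPoly_sub (p q : ℚ[X]) : ofPoly (p - q) = ofPoly p - ofPoly q := map_sub polyHom p q

theorem ofPoly_zero : ofPoly 0 = 0 := map_zero polyHom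

theorem ofPoly_one : ofPoly 1 = 1 := map_one polyHom

theorem ofPoly_monomial (k : ℕ) (a : ℚ) :
    ofPoly (monomial k a) = HahnSeries.single (-(k : ℤ)) a := by
  have : algebraMap ℚ SeriesAtInfinity a = HahnSeries.single 0 a :=
    RingHom.congr_fun (Subsingleton.elim (algebraMap ℚ SeriesAtInfinity) HahnSeries.C) a
  rw [ofPoly, aeval_monomial, HahnSeries.single_pow, this, HahnSeries.single_mul_single]
  simp

theorem coeff_monomial_mul (k : ℕ) (a : ℚ) (g : SeriesAtInfinity) (n : ℤ) :
    (ofPoly (monomial k a) * g).coeff n = a * g.coeff (n + k) := by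
  rw [ofPoly_monomial, HahnSeries.coeff_single_mul]
  simp

theorem coeff_ofPoly_mul (p : ℚ[X]) (g : SeriesAtInfinity) (n : ℤ) :
    (ofPoly p * g).coeff n = p.sum fun k a => a * g.coeff (n + k) := by
  induction p using Polynomial.induction_on' with
  | add p q hp hq =>
    rw [ofPoly_add, add_mul, HahnSeries.coeff_add, hp, hq, Polynomial.sum_add_index]
    · simp
    · intros; ring
  | monomial k a => rw [coeff_monomial_mul, Polynomial.sum_monomial_index _ _ (by simp)]

theorem coeff_ofPoly (p : ℚ[X]) (n : ℤ) :
    (ofPoly p).coeff n = if n ≤ 0 then p.coeff n.natAbs else 0 := by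
  induction p using Polynomial.induction_on' with
  | add p q hp hq =>
    rw [ofPoly_add, HahnSeries.coeff_add, hp, hq]
    split_ifs <;> simp
  | monomial k a =>
    rw [ofPoly_monomial, HahnSeries.coeff_single, Polynomial.coeff_monomial]
    split_ifs <;> first | rfl | omega

theorem ofPoly_injective : Function.Injective ofPoly := by
  intro p q h
  ext k
  have := congrArg (fun g => HahnSeries.coeff g (-(k : ℤ))) h
  simpa [coeff_ofPoly] using this

theorem ofPoly_ne_zero {p : ℚ[X]} (hp : p ≠ 0) : ofPoly p ≠ 0 := fun h =>
  hp (ofPoly_injective (h.trans ofPoly_zero.symm))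

theorem order_ofPoly {p : ℚ[X]} (hp : p ≠ 0) : (ofPoly p).order = -(p.natDegree : ℤ) := by
  apply le_antisymm
  · apply HahnSeries.order_le_of_coeff_ne_zero
    rw [coeff_ofPoly]
    simpa using hp
  · rw [HahnSeries.le_order_iff_forall (ofPoly_ne_zero hp)]
    intro j hj
    rw [coeff_ofPoly, if_pos (by omega)]
    apply coeff_eq_zero_of_natDegree_lt
    omega

/-- The polynomial part of a Laurent series. -/
theorem exists_polynomial_part (g : SeriesAtInfinity) :
    ∃ p : ℚ[X], ∀ n : ℤ, n ≤ 0 → (g - ofPoly p).coeff n = 0 := by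
  refine ⟨∑ k ∈ Finset.range (g.order.natAbs + 1), monomial k (g.coeff (-(k : ℤ))), ?_⟩
  intro n hn
  rw [HahnSeries.coeff_sub, coeff_ofPoly, if_pos hn, finsetSum_coeff]
  simp only [coeff_monomial, Finset.sum_ite_eq', Finset.mem_range]
  have hn' : -(n.natAbs : ℤ) = n := by omega
  rw [hn']
  split_ifs with h
  · simp
  · rw [HahnSeries.coeff_eq_zero_of_lt_order (by omega)]; simp

/-! ### The substitution `z ↦ z ^ d` -/

section subst

variable {d : ℕ} (hd : 0 < d)

theorem substPow_mul (f g : SeriesAtInfinity) :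
    substPow d hd (f * g) = substPow d hd f * substPow d hd g :=
  HahnSeries.embDomain_mul _ (fun x y => mul_add (d : ℤ) x y) f g

theorem substPow_add (f g : SeriesAtInfinity) :
    substPow d hd (f + g) = substPow d hd f + substPow d hd g :=
  HahnSeries.embDomain_add _ f g

theorem substPow_sub (f g : SeriesAtInfinity) :
    substPow d hd (f - g) = substPow d hd f - substPow d hd g := by
  rw [eq_sub_iff_add_eq, ← substPow_add, sub_add_cancel]

theorem coeff_substPow_mul (f : SeriesAtInfinity) (n : ℤ) :
    (substPow d hd f).coeff (d * n) = f.coeff n :=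
  HahnSeries.embDomain_coeff (f := mulEmb d hd) (a := n)

theorem coeff_substPow_of_not_dvd (f : SeriesAtInfinity) {n : ℤ} (hn : ¬ (d : ℤ) ∣ n) :
    (substPow d hd f).coeff n = 0 :=
  HahnSeries.embDomain_of_notMem_range (by
    rintro ⟨m, rfl⟩
    exact hn ⟨m, rfl⟩)

theorem substPow_ofPoly (p : ℚ[X]) : substPow d hd (ofPoly p) = ofPoly (expand ℚ d p) := by
  induction p using Polynomial.induction_on' with
  | add p q hp hq => rw [ofPoly_add, substPow_add, hp, hq, map_add, ofPoly_add]
  | monomial k a =>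
    rw [expand_monomial, ofPoly_monomial, ofPoly_monomial]
    unfold substPow
    rw [HahnSeries.embDomain_single]
    have : mulEmb d hd (-(k : ℤ)) = -((k * d : ℕ) : ℤ) := by
      change (d : ℤ) * -(k : ℤ) = _
      push_cast; ring
    rw [this]

theorem substPow_injective : Function.Injective (substPow d hd) :=
  HahnSeries.embDomain_injective

theorem substPow_ne_zero {f : SeriesAtInfinity} (hf : f ≠ 0) : substPow d hd f ≠ 0 := fun h =>
  hf (substPow_injective hd (h.trans HahnSeries.embDomain_zero.symm))

theorem order_substPow {f : SeriesAtInfinity} (hf : f ≠ 0) :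
    (substPow d hd f).order = d * f.order := by
  apply le_antisymm
  · apply HahnSeries.order_le_of_coeff_ne_zero
    rw [coeff_substPow_mul]
    exact mt HahnSeries.coeff_order_eq_zero.1 hf
  · rw [HahnSeries.le_order_iff_forall (substPow_ne_zero hd hf)]
    intro j hj
    by_cases h : (d : ℤ) ∣ j
    · obtain ⟨k, rfl⟩ := h
      rw [coeff_substPow_mul]
      apply HahnSeries.coeff_eq_zero_of_lt_order
      exact lt_of_mul_lt_mul_left hj (by positivity)
    · exact coeff_substPow_of_not_dvd hd f h

end subst

/-! ### Values -/

/-- The series `g` converges at the real point `x` with sum `v`. -/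
def HasVal (g : SeriesAtInfinity) (x v : ℝ) : Prop :=
  HasSum (fun n : ℤ => (g.coeff n : ℝ) * x ^ (-n)) v

namespace HasVal

variable {g h : SeriesAtInfinity} {x v w : ℝ}

theorem unique (hv : HasVal g x v) (hw : HasVal g x w) : v = w := HasSum.unique hv hw

theorem value_eq (hv : HasVal g x v) : value g x = v := HasSum.tsum_eq hv

theorem sub (hv : HasVal g x v) (hw : HasVal h x w) : HasVal (g - h) x (v - w) := by
  have := HasSum.sub hv hw
  unfold HasVal
  convert! this using 2 with n
  rw [HahnSeries.coeff_sub]; push_cast; ring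

theorem add (hv : HasVal g x v) (hw : HasVal h x w) : HasVal (g + h) x (v + w) := by
  have := HasSum.add hv hw
  unfold HasVal
  convert! this using 2 with n
  rw [HahnSeries.coeff_add]; push_cast; ring

theorem monomial_mul (hx : x ≠ 0) (hv : HasVal g x v) (k : ℕ) (a : ℚ) :
    HasVal (ofPoly (monomial k a) * g) x (a * x ^ k * v) := by
  have h := (((Equiv.addRight (k : ℤ)).hasSum_iff).2 hv).mul_left ((a : ℝ) * x ^ k)
  unfold HasVal
  convert! h using 2 with n
  simp only [Function.comp_apply, Equiv.coe_addRight]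
  rw [coeff_monomial_mul, neg_add, zpow_add₀ hx, zpow_neg x (k : ℤ), zpow_natCast]
  push_cast
  field_simp

theorem polynomial_mul (hx : x ≠ 0) (hv : HasVal g x v) (p : ℚ[X]) :
    HasVal (ofPoly p * g) x (p.aeval x * v) := by
  induction p using Polynomial.induction_on' with
  | add p q hp hq =>
    rw [ofPoly_add, add_mul, map_add, add_mul]
    exact hp.add hq
  | monomial k a =>
    rw [aeval_monomial]
    exact hv.monomial_mul hx k a

theorem one (x : ℝ) : HasVal 1 x 1 := by
  have := hasSum_single (f := fun n : ℤ => (((1 : SeriesAtInfinity).coeff n : ℚ) : ℝ) * x ^ (-n))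
    0 (by
      intro n hn
      rw [HahnSeries.coeff_one, if_neg hn]; simp)
  simpa [HasVal, HahnSeries.coeff_one] using this

theorem polynomial (hx : x ≠ 0) (p : ℚ[X]) : HasVal (ofPoly p) x (p.aeval x) := by
  simpa using (HasVal.one x).polynomial_mul hx p

theorem subst {d : ℕ} (hd : 0 < d) (hv : HasVal g (x ^ d) v) :
    HasVal (substPow d hd g) x v := by
  have hinj : Function.Injective (fun n : ℤ => (d : ℤ) * n) :=
    fun a b h => by simpa [hd.ne'] using h
  refine (hinj.hasSum_iff ?_).1 ?_
  · intro n hn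
    rw [coeff_substPow_of_not_dvd hd]
    · simp
    · rintro ⟨m, rfl⟩
      exact hn ⟨m, rfl⟩
  · unfold HasVal at hv
    convert! hv using 2 with n
    simp only [Function.comp_apply]
    rw [coeff_substPow_mul, ← zpow_natCast x d, ← zpow_mul]
    congr 2
    ring

/-- A series that converges at `r > 0` converges at all points of absolute value at least `r`. -/
theorem exists_of_le {r : ℝ} (hr : 0 < r) (hv : HasVal g r v) (hx : r ≤ |x|) :
    ∃ w, HasVal g x w := by
  have hx0 : 0 < |x| := hr.trans_le hx
  -- Only exponents from `g.order` on contribute, and there `(|x| / r) ^ (-n)` is at most its value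
  -- at `g.order`.
  have hs : Summable fun n : ℤ => (|(g.coeff n : ℝ) * r ^ (-n)|) * (|x| / r) ^ (-g.order) :=
    (HasSum.summable hv).abs.mul_right _
  refine (Summable.of_norm_bounded hs ?_ : Summable fun n : ℤ => (g.coeff n : ℝ) * x ^ (-n))
  intro n
  by_cases hn : n < g.order
  · rw [HahnSeries.coeff_eq_zero_of_lt_order hn]; simp
  · rw [Real.norm_eq_abs, abs_mul, abs_mul, abs_zpow, abs_zpow, abs_of_pos hr, mul_assoc]
    gcongr
    have h1 : (|x| / r) ^ (-n) ≤ (|x| / r) ^ (-g.order) :=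
      zpow_le_zpow_right₀ ((one_le_div hr).2 hx) (by omega)
    calc |x| ^ (-n) = r ^ (-n) * (|x| / r) ^ (-n) := by
          rw [div_zpow]; field_simp
      _ ≤ _ := by gcongr

/-- The leading term of a convergent series dominates at infinity. -/
theorem tendsto_mul_pow_order {r : ℝ} (hr : 0 < r) (hv : HasVal g r v) {y : ℕ → ℝ} {w : ℕ → ℝ}
    (hy : Tendsto (fun m => |y m|) atTop atTop) (hw : ∀ m, HasVal g (y m) (w m)) :
    Tendsto (fun m => w m * y m ^ g.order) atTop (𝓝 (g.coeff g.order : ℝ)) := by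
  have hs : Summable fun n : ℤ => |(g.coeff n : ℝ) * r ^ (-n)| * r ^ g.order :=
    (HasSum.summable hv).abs.mul_right _
  have hlim : ∀ n : ℤ, Tendsto (fun m => (g.coeff n : ℝ) * y m ^ (-n) * y m ^ g.order) atTop
      (𝓝 (if n = g.order then (g.coeff g.order : ℝ) else 0)) := by
    intro n
    have hne : ∀ᶠ m in atTop, y m ≠ 0 := by
      filter_upwards [hy.eventually_gt_atTop 0] with m hm
      exact abs_pos.1 hm
    rcases lt_trichotomy n g.order with h | h | h
    · rw [HahnSeries.coeff_eq_zero_of_lt_order h, if_neg h.ne]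
      simp
    · rw [if_pos h]
      refine tendsto_const_nhds.congr' ?_
      filter_upwards [hne] with m hm
      rw [h, mul_assoc, ← zpow_add₀ hm]
      simp
    · rw [if_neg h.ne']
      obtain ⟨k, hk, hk0⟩ : ∃ k : ℕ, n = g.order + k ∧ k ≠ 0 :=
        ⟨(n - g.order).toNat, by omega, by omega⟩
      have h1 : Tendsto (fun m => |(g.coeff n : ℝ)| * (|y m| ^ k)⁻¹) atTop (𝓝 (|(g.coeff n : ℝ)| * 0)) :=
        ((tendsto_pow_atTop hk0).comp hy).inv_tendsto_atTop.const_mul _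
      rw [mul_zero] at h1
      refine (tendsto_zero_iff_abs_tendsto_zero _).2 (h1.congr' ?_)
      filter_upwards [hne] with m hm
      simp only [Function.comp_apply]
      rw [mul_assoc, ← zpow_add₀ hm, abs_mul, hk, neg_add, neg_add_cancel_comm, zpow_neg,
        zpow_natCast, abs_inv, abs_pow]
  -- Once `|y m| ≥ r`, the factor `|y m| ^ (g.order - n)` is at most `r ^ (g.order - n)` for every
  -- `n ≥ g.order`.
  have key := tendsto_tsum_of_dominated_convergence hs hlim (by
    filter_upwards [hy.eventually_ge_atTop r] with m hm n
    have hm0 : 0 < |y m| := hr.trans_le hm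
    by_cases hn : n < g.order
    · rw [HahnSeries.coeff_eq_zero_of_lt_order hn]; simp
    · have hne : y m ≠ 0 := abs_pos.1 hm0
      rw [mul_assoc, ← zpow_add₀ hne, Real.norm_eq_abs, abs_mul, abs_mul, abs_zpow, abs_zpow,
        abs_of_pos hr, mul_assoc, ← zpow_add₀ hr.ne']
      gcongr
      obtain ⟨k, hk⟩ : ∃ k : ℕ, -n + g.order = -(k : ℤ) := ⟨(n - g.order).toNat, by omega⟩
      rw [hk, zpow_neg, zpow_neg, zpow_natCast, zpow_natCast]
      gcongr)
  rw [tsum_ite_eq] at key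
  refine key.congr fun m => ?_
  exact ((hw m).mul_right _).tsum_eq

end HasVal

/-! ### Series converging on the unit circle are rational -/

/-- The coefficients of `g` are `O(θ ^ n)`. -/
def Decays (g : SeriesAtInfinity) (θ : ℝ) : Prop :=
  ∃ C : ℝ, ∀ n : ℤ, |(g.coeff n : ℝ)| ≤ C * θ ^ n

namespace Decays

variable {g h : SeriesAtInfinity} {θ : ℝ}

theorem add (hg : Decays g θ) (hh : Decays h θ) : Decays (g + h) θ := by
  obtain ⟨C, hC⟩ := hg
  obtain ⟨C', hC'⟩ := hh
  refine ⟨C + C', fun n => ?_⟩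
  rw [HahnSeries.coeff_add, add_mul]
  push_cast
  exact (abs_add_le _ _).trans (add_le_add (hC n) (hC' n))

theorem polynomial_mul (hθ : 0 < θ) (hg : Decays g θ) (p : ℚ[X]) : Decays (ofPoly p * g) θ := by
  induction p using Polynomial.induction_on' with
  | add p q hp hq =>
    rw [ofPoly_add, add_mul]
    exact hp.add hq
  | monomial k a =>
    obtain ⟨C, hC⟩ := hg
    refine ⟨|(a : ℝ)| * C * θ ^ k, fun n => ?_⟩
    rw [coeff_monomial_mul]
    push_cast
    rw [abs_mul]
    calc _ ≤ |(a : ℝ)| * (C * θ ^ (n + k)) := by gcongr; exact hC _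
      _ = _ := by rw [zpow_add₀ hθ.ne', zpow_natCast]; ring

theorem of_substPow {d : ℕ} (hd : 0 < d) (hg : Decays (substPow d hd g) θ) :
    Decays g (θ ^ d) := by
  obtain ⟨C, hC⟩ := hg
  refine ⟨C, fun n => ?_⟩
  have := hC (d * n)
  rwa [coeff_substPow_mul, zpow_mul, zpow_natCast] at this

theorem of_summable {r : ℝ} (hr : 0 < r)
    (hs : Summable fun n : ℤ => |(g.coeff n : ℝ)| * r ^ (-n)) : Decays g r := by
  refine ⟨∑' n : ℤ, |(g.coeff n : ℝ)| * r ^ (-n), fun n => ?_⟩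
  have h := hs.le_tsum n fun m _ => by positivity
  rw [zpow_neg, ← div_eq_mul_inv, div_le_iff₀ (by positivity)] at h
  exact h

end Decays

/-- The coefficients of `g` have denominators dividing `K N ^ n`. -/
def DenomBounded (g : SeriesAtInfinity) (N : ℤ) : Prop :=
  ∃ K : ℤ, K ≠ 0 ∧ ∀ n : ℤ, (K : ℚ) * (N : ℚ) ^ n.toNat * g.coeff n ∈ (Int.castRingHom ℚ).range

theorem intCast_mem_range (z : ℤ) : (z : ℚ) ∈ (Int.castRingHom ℚ).range := ⟨z, rfl⟩

theorem DenomBounded.polynomial_mul {g : SeriesAtInfinity} {N : ℤ} (hN : N ≠ 0)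
    (hg : DenomBounded g N) (p : ℚ[X]) : DenomBounded (ofPoly p * g) N := by
  induction p using Polynomial.induction_on' with
  | add p q hp hq =>
    obtain ⟨K, hK, h⟩ := hp
    obtain ⟨K', hK', h'⟩ := hq
    refine ⟨K * K', mul_ne_zero hK hK', fun n => ?_⟩
    have := add_mem (mul_mem (intCast_mem_range K') (h n)) (mul_mem (intCast_mem_range K) (h' n))
    rw [ofPoly_add, add_mul, HahnSeries.coeff_add]
    convert this using 1
    push_cast; ring
  | monomial k a =>
    obtain ⟨K, hK, h⟩ := hg
    refine ⟨K * a.den * N ^ k, by simp [hK, hN], fun n => ?_⟩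
    obtain ⟨e, he⟩ : ∃ e : ℕ, n.toNat + k = (n + k).toNat + e :=
      ⟨n.toNat + k - (n + k).toNat, by omega⟩
    have := mul_mem (intCast_mem_range (a.num * N ^ e)) (h (n + k))
    rw [coeff_monomial_mul]
    convert this using 1
    push_cast
    rw [← Rat.mul_den_eq_num a]
    have : (N : ℚ) ^ k * (N : ℚ) ^ n.toNat = N ^ (n + k).toNat * N ^ e := by
      rw [← pow_add, ← pow_add, ← he, add_comm]
    linear_combination (K : ℚ) * a.den * a * g.coeff (n + k) * this

/-- `AdjoinRoot P` is finite-dimensional over `ℚ`, so the `d`-th power of its generator is a root of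
some nonzero `W`. This supplies multiples in `z ^ d`, to which the functional equation applies. -/
theorem exists_mul_eq_expand {d : ℕ} {P : ℚ[X]} (hP : P ≠ 0) :
    ∃ U W : ℚ[X], W ≠ 0 ∧ U * P = expand ℚ d W := by
  have : Module.Finite ℚ (AdjoinRoot P) := (AdjoinRoot.powerBasis hP).finite
  obtain ⟨W, hW, h⟩ := Algebra.IsAlgebraic.isAlgebraic (R := ℚ) (AdjoinRoot.root P ^ d)
  have h2 : AdjoinRoot.mk P (expand ℚ d W) = 0 := by
    rw [← AdjoinRoot.aeval_eq, expand_aeval, h]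
  obtain ⟨U, hU⟩ := AdjoinRoot.mk_eq_zero.1 h2
  exact ⟨U, W, hW, by rw [hU, mul_comm]⟩

/-! ### Consequences of the functional equation for decay and denominators of coefficients -/

section

variable {d : ℕ} {f : SeriesAtInfinity}

/-- If `U S A = W(z ^ d)`, the equation gives `(W f)(z ^ d) = U B S f`. The right side decays like
`S f`, and undoing the substitution raises the rate to its `d`-th power. -/
theorem exists_mul_decays (hd0 : 0 < d) {A B : ℚ[X]} (hA : A ≠ 0)
    (hf : ofPoly B * f = ofPoly A * substPow d hd0 f) {θ : ℝ} (hθ : 0 < θ) (h : Decays f θ)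
    (k : ℕ) : ∃ S : ℚ[X], S ≠ 0 ∧ Decays (ofPoly S * f) (θ ^ d ^ k) := by
  induction k with
  | zero => exact ⟨1, one_ne_zero, by simpa [ofPoly_one] using h⟩
  | succ k ih =>
    obtain ⟨S, hS, hdec⟩ := ih
    obtain ⟨U, W, hW, hU⟩ := exists_mul_eq_expand (d := d) (mul_ne_zero hS hA)
    refine ⟨W, hW, ?_⟩
    rw [pow_succ, pow_mul]
    apply Decays.of_substPow hd0
    rw [substPow_mul, substPow_ofPoly, ← hU, ofPoly_mul, ofPoly_mul, mul_assoc, mul_assoc, ← hf]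
    have := hdec.polynomial_mul (by positivity) (U * B)
    rw [ofPoly_mul] at this
    convert this using 1
    ring

/-- Comparing coefficients gives a recurrence expressing `N` times a coefficient of `f` integrally
through earlier ones, so each new index costs one factor `N`. -/
theorem denomBounded (hd : 2 ≤ d) {A B : ℤ[X]} (hd0 : 0 < d)
    (hf : ofPoly (B.map (Int.castRingHom ℚ)) * f =
      ofPoly (A.map (Int.castRingHom ℚ)) * substPow d hd0 f) (hB : B ≠ 0) :
    DenomBounded f B.leadingCoeff := by
  set Z := (Int.castRingHom ℚ).range
  set D := B.natDegree
  set N := B.leadingCoeff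
  have hN : N ≠ 0 := leadingCoeff_ne_zero.2 hB
  have hrec : ∀ n : ℤ, (N : ℚ) * f.coeff (n + D) =
      (∑ j ∈ Finset.range (A.natDegree + 1), (A.coeff j : ℚ) * (substPow d hd0 f).coeff (n + j)) -
      ∑ k ∈ Finset.range D, (B.coeff k : ℚ) * f.coeff (n + k) := by
    intro n
    have h := congrArg (fun g => HahnSeries.coeff g n) hf
    simp only [coeff_ofPoly_mul] at h
    rw [sum_over_range' _ (by simp) (D + 1) (Nat.lt_succ_of_le natDegree_map_le),
      sum_over_range' _ (by simp) (A.natDegree + 1) (Nat.lt_succ_of_le natDegree_map_le),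
      Finset.sum_range_succ] at h
    simp only [coeff_map, eq_intCast] at h
    change _ + (N : ℚ) * _ = _ at h
    linarith
  -- `K` clears the coefficients up to index `A.natDegree`; beyond it the recurrence only reaches
  -- back to smaller indices.
  set K : ℤ := ∏ n ∈ Finset.Icc f.order (A.natDegree : ℤ), ((f.coeff n).den : ℤ)
  have hK : K ≠ 0 := Finset.prod_ne_zero_iff.2 fun n _ => by simp
  have hbase : ∀ n : ℤ, n ≤ A.natDegree → (K : ℚ) * f.coeff n ∈ Z := by
    intro n hn
    by_cases h : n < f.order
    · rw [HahnSeries.coeff_eq_zero_of_lt_order h, mul_zero]; exact zero_mem _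
    · obtain ⟨c, hc⟩ := Finset.dvd_prod_of_mem (fun n => ((f.coeff n).den : ℤ))
        (Finset.mem_Icc.2 ⟨not_lt.1 h, hn⟩)
      have : (K : ℚ) * f.coeff n = ((c * (f.coeff n).num : ℤ) : ℚ) := by
        change K = _ at hc
        rw [hc]; push_cast
        rw [← Rat.mul_den_eq_num (f.coeff n)]; ring
      rw [this]; exact intCast_mem_range _
  refine ⟨K, hK, ?_⟩
  suffices H : ∀ k : ℕ, ∀ n : ℤ, n ≤ k → (K : ℚ) * (N : ℚ) ^ k * f.coeff n ∈ Z by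
    intro n
    rcases le_total n 0 with h | h
    · rw [Int.toNat_of_nonpos h]
      exact H 0 n (by simpa using h)
    · exact H n.toNat n (by omega)
  intro k
  induction k with
  | zero =>
    intro n hn
    simpa using hbase n (by omega)
  | succ k ih =>
    intro n hn
    by_cases h1 : n ≤ k
    · have := mul_mem (intCast_mem_range N) (ih n h1)
      convert this using 1; ring
    by_cases h2 : n ≤ A.natDegree
    · have := mul_mem (intCast_mem_range (N ^ (k + 1))) (hbase n h2)
      convert this using 1; push_cast; ring
    have h3 := hrec (n - D)
    rw [sub_add_cancel] at h3
    have h4 : (K : ℚ) * (N : ℚ) ^ (k + 1) * f.coeff n =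
        (∑ j ∈ Finset.range (A.natDegree + 1),
          (A.coeff j : ℚ) * (K * N ^ k * (substPow d hd0 f).coeff (n - D + j))) -
        ∑ i ∈ Finset.range D, (B.coeff i : ℚ) * (K * N ^ k * f.coeff (n - D + i)) := by
      rw [show (K : ℚ) * (N : ℚ) ^ (k + 1) * f.coeff n = K * N ^ k * (N * f.coeff n) by ring, h3,
        mul_sub, Finset.mul_sum, Finset.mul_sum]
      congr 1 <;> exact Finset.sum_congr rfl fun _ _ => by ring
    rw [h4]
    refine sub_mem (sum_mem fun j hj => mul_mem (intCast_mem_range _) ?_)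
      (sum_mem fun i hi => mul_mem (intCast_mem_range _) (ih _ ?_))
    · by_cases hdiv : (d : ℤ) ∣ n - D + j
      · obtain ⟨m, hm⟩ := hdiv
        rw [hm, coeff_substPow_mul]
        apply ih
        rw [Finset.mem_range] at hj
        -- As `j ≤ A.natDegree < n`, one has `d * m < 2 * n`, which forces `m < n ≤ k + 1`.
        by_contra hlt
        have : 2 * m ≤ d * m := by
          have : (2 : ℤ) ≤ d := by exact_mod_cast hd
          nlinarith
        omega
      · rw [coeff_substPow_of_not_dvd hd0 f hdiv, mul_zero]; exact zero_mem _
    · rw [Finset.mem_range] at hi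
      omega

/-- A solution of the functional equation which converges on the unit circle is rational. -/
theorem exists_mul_eq_ofPoly_of_decays {A B : ℤ[X]} (hd0 : 0 < d) (hd : 2 ≤ d)
    (hf : ofPoly (B.map (Int.castRingHom ℚ)) * f =
      ofPoly (A.map (Int.castRingHom ℚ)) * substPow d hd0 f) (hA : A ≠ 0) (hB : B ≠ 0)
    {r : ℝ} (hr : 0 < r) (hr1 : r < 1) (h : Decays f r) :
    ∃ q p : ℚ[X], q ≠ 0 ∧ ofPoly q * f = ofPoly p := by
  have hA' : A.map (Int.castRingHom ℚ) ≠ 0 :=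
    (Polynomial.map_ne_zero_iff Int.cast_injective).2 hA
  set N := |(B.leadingCoeff : ℝ)|
  have hN : 0 < N := abs_pos.2 (by exact_mod_cast leadingCoeff_ne_zero.2 hB)
  -- With this decay the integers `K N ^ n` times the `n`-th coefficient of `S f` tend to zero,
  -- hence vanish eventually.
  obtain ⟨k, hk⟩ : ∃ k : ℕ, N * r ^ d ^ k < 1 := by
    have h1 : Tendsto (fun k : ℕ => N * r ^ d ^ k) atTop (𝓝 (N * 0)) :=
      ((tendsto_pow_atTop_nhds_zero_of_lt_one hr.le hr1).comp
        (tendsto_pow_atTop_atTop_of_one_lt (by omega))).const_mul N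
    rw [mul_zero] at h1
    exact (h1.eventually_lt_const one_pos).exists
  obtain ⟨S, hS, C, hC⟩ := exists_mul_decays hd0 hA' hf hr h k
  obtain ⟨K, hK, hden⟩ := (denomBounded hd hd0 hf hB).polynomial_mul
    (leadingCoeff_ne_zero.2 hB) S
  set θ := r ^ d ^ k
  have hθ : 0 < θ := by positivity
  have hlim : Tendsto (fun n : ℕ => |(K : ℝ)| * C * (N * θ) ^ n) atTop (𝓝 (|(K : ℝ)| * C * 0)) :=
    (tendsto_pow_atTop_nhds_zero_of_lt_one (by positivity) hk).const_mul _
  rw [mul_zero] at hlim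
  obtain ⟨n₀, hn₀⟩ := eventually_atTop.1 (hlim.eventually_lt_const one_pos)
  have hzero : ∀ n : ℕ, n₀ ≤ n → (ofPoly S * f).coeff n = 0 := by
    intro n hn
    obtain ⟨z, hz⟩ := hden n
    have hzR : (K : ℝ) * (B.leadingCoeff : ℝ) ^ n * ((ofPoly S * f).coeff n : ℝ) = z := by
      have := congrArg (fun x : ℚ => (x : ℝ)) hz
      simpa using this.symm
    have hlt : |(z : ℝ)| < 1 := by
      rw [← hzR, abs_mul, abs_mul, abs_pow]
      calc _ ≤ |(K : ℝ)| * N ^ n * (C * θ ^ (n : ℤ)) := by gcongr; exact hC n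
        _ = |(K : ℝ)| * C * (N * θ) ^ n := by rw [zpow_natCast]; ring
        _ < 1 := hn₀ n hn
    have hz0 : z = 0 := by
      rw [← Int.cast_abs] at hlt
      exact Int.abs_lt_one_iff.1 (by exact_mod_cast hlt)
    rw [hz0] at hzR
    have hlc : (B.leadingCoeff : ℝ) ≠ 0 := by exact_mod_cast leadingCoeff_ne_zero.2 hB
    have hK' : (K : ℝ) ≠ 0 := by exact_mod_cast hK
    have := (mul_eq_zero.1 (hzR.trans Int.cast_zero)).resolve_left (by positivity)
    exact_mod_cast this
  obtain ⟨p, hp⟩ := exists_polynomial_part (ofPoly (monomial n₀ 1 * S) * f)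
  refine ⟨monomial n₀ 1 * S, p, mul_ne_zero (by simp) hS, ?_⟩
  rw [← sub_eq_zero]
  ext n
  rcases le_or_gt n 0 with hn | hn
  · exact hp n hn
  · rw [HahnSeries.coeff_sub, coeff_ofPoly, if_neg (by omega), ofPoly_mul, mul_assoc,
      coeff_monomial_mul]
    obtain ⟨m, hm⟩ : ∃ m : ℕ, n + n₀ = m ∧ n₀ ≤ m := ⟨(n + n₀).toNat, by omega, by omega⟩
    rw [hm.1, hzero m hm.2]
    simp

end

/-! ### Rational approximations to a Laurent series -/

/-- The order of vanishing at infinity of `q f - p`. -/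
def errOrder (f : SeriesAtInfinity) (p q : ℚ[X]) : ℤ := (ofPoly q * f - ofPoly p).order

/-- `f` is not a rational function. -/
def NotRational (f : SeriesAtInfinity) : Prop := ∀ p q : ℚ[X], q ≠ 0 → ofPoly q * f ≠ ofPoly p

theorem NotRational.sub_ne_zero {f : SeriesAtInfinity} (hf : NotRational f) (p : ℚ[X]) {q : ℚ[X]}
    (hq : q ≠ 0) : ofPoly q * f - ofPoly p ≠ 0 := _root_.sub_ne_zero.2 (hf p q hq)

/-- The pair `(p, q)` is a reduced Padé approximation of `f` of degree `n`. -/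
structure IsPade (f : SeriesAtInfinity) (n : ℕ) (p q : ℚ[X]) : Prop where
  ne_zero : q ≠ 0
  coprime : IsCoprime p q
  natDegree_le : q.natDegree ≤ n
  lt_errOrder : (n : ℤ) < errOrder f p q

/-- These are `n` linear conditions on the `n + 1` coefficients of `q`. -/
theorem exists_ne_zero_coeff_eq_zero (f : SeriesAtInfinity) (n : ℕ) :
    ∃ q : ℚ[X], q ≠ 0 ∧ q.natDegree ≤ n ∧
      ∀ m : ℤ, 0 < m → m ≤ n → (ofPoly q * f).coeff m = 0 := by
  let φ : degreeLT ℚ (n + 1) →ₗ[ℚ] (Fin n → ℚ) :=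
    { toFun := fun q i => (ofPoly q.1 * f).coeff (i + 1)
      map_add' := fun p q => by
        ext i
        simp [ofPoly_add, add_mul]
      map_smul' := fun c q => by
        ext i
        change (ofPoly (c • q.1) * f).coeff _ = c * _
        rw [smul_eq_C_mul, ofPoly_mul, mul_assoc, ← monomial_zero_left, coeff_monomial_mul]
        simp }
  have hker : LinearMap.ker φ ≠ ⊥ := by
    apply LinearMap.ker_ne_bot_of_finrank_lt
    rw [(degreeLTEquiv ℚ (n + 1)).finrank_eq]
    simp
  obtain ⟨q, hq, hq0⟩ := (Submodule.ne_bot_iff _).1 hker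
  refine ⟨q.1, fun h => hq0 (Subtype.ext h), ?_, ?_⟩
  · have := mem_degreeLT.1 q.2
    exact Nat.lt_succ_iff.1 ((natDegree_lt_iff_degree_lt (fun h => hq0 (Subtype.ext h))).2 this)
  · intro m hm hmn
    have := congrFun (LinearMap.mem_ker.1 hq) ⟨(m - 1).toNat, by omega⟩
    change (ofPoly q.1 * f).coeff _ = 0 at this
    convert this using 2
    simp only
    omega

theorem exists_isPade {f : SeriesAtInfinity} (hf : NotRational f) (n : ℕ) :
    ∃ p q : ℚ[X], IsPade f n p q := by
  obtain ⟨q, hq, hdeg, hcoeff⟩ := exists_ne_zero_coeff_eq_zero f n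
  obtain ⟨p, hp⟩ := exists_polynomial_part (ofPoly q * f)
  have hord : (n : ℤ) < (ofPoly q * f - ofPoly p).order := by
    refine Int.lt_of_add_one_le ((HahnSeries.le_order_iff_forall (hf.sub_ne_zero p hq)).2 ?_)
    intro m hm
    rcases le_or_gt m 0 with h | h
    · exact hp m h
    · rw [HahnSeries.coeff_sub, hcoeff m h (by omega), coeff_ofPoly, if_neg (by omega), sub_zero]
  have hg : gcd p q ≠ 0 := fun h => hq ((gcd_eq_zero_iff _ _).1 h).2
  obtain ⟨p', q', hcop, hp', hq'⟩ : ∃ p' q', IsCoprime p' q' ∧ p = gcd p q * p' ∧ q = gcd p q * q' := by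
    obtain ⟨p', q', hp', hq', h⟩ := extract_gcd p q
    exact ⟨p', q', (gcd_isUnit_iff _ _).1 h, hp', hq'⟩
  have hq'0 : q' ≠ 0 := fun h => hq (by rw [hq', h, mul_zero])
  refine ⟨p', q', hq'0, hcop, ?_, ?_⟩
  · rw [hq', natDegree_mul hg hq'0] at hdeg
    omega
  · have h1 : ofPoly q * f - ofPoly p = ofPoly (gcd p q) * (ofPoly q' * f - ofPoly p') := by
      rw [mul_sub, ← mul_assoc, ← ofPoly_mul, ← ofPoly_mul, ← hp', ← hq']
    rw [h1, HahnSeries.order_mul (ofPoly_ne_zero hg) (hf.sub_ne_zero p' hq'0), order_ofPoly hg]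
      at hord
    unfold errOrder
    omega

/-! ### The dynamics of approximations under the functional equation -/

/-- The relation `p₁/q₁ = (A/B) (p/q)(z ^ d)`. -/
def Step (d : ℕ) (A B p q p₁ q₁ : ℚ[X]) : Prop :=
  p₁ * expand ℚ d q * B = q₁ * expand ℚ d p * A

section

variable {d : ℕ} {A B p q p₁ q₁ : ℚ[X]}

theorem expand_ne_zero' (hd : 0 < d) (hq : q ≠ 0) : expand ℚ d q ≠ 0 :=
  (expand_ne_zero hd).2 hq

theorem isCoprime_expand (h : IsCoprime p q) : IsCoprime (expand ℚ d p) (expand ℚ d q) :=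
  h.map (expand ℚ d).toRingHom

/-- The numerator and denominator of the substituted fraction stay coprime, so only `A` can cancel
against `expand ℚ d q`. -/
theorem Step.le_natDegree_add (h : Step d A B p q p₁ q₁) (hpq : IsCoprime p q)
    (hA : A ≠ 0) (hq₁ : q₁ ≠ 0) : d * q.natDegree ≤ q₁.natDegree + A.natDegree := by
  have h1 : expand ℚ d q ∣ (q₁ * A) * expand ℚ d p :=
    ⟨p₁ * B, by rw [mul_right_comm, ← h]; ring⟩
  have h2 := natDegree_le_of_dvd ((isCoprime_expand hpq).symm.dvd_of_dvd_mul_right h1)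
    (mul_ne_zero hq₁ hA)
  rwa [natDegree_expand, natDegree_mul hq₁ hA, mul_comm] at h2

theorem Step.natDegree_le (hd : 0 < d) (h : Step d A B p q p₁ q₁) (hpq : IsCoprime p₁ q₁)
    (hB : B ≠ 0) (hq : q ≠ 0) : q₁.natDegree ≤ d * q.natDegree + B.natDegree := by
  have h1 : q₁ ∣ (expand ℚ d q * B) * p₁ :=
    ⟨expand ℚ d p * A, by rw [mul_comm _ p₁, ← mul_assoc, h]; ring⟩
  have hq' := expand_ne_zero' hd hq
  have h2 := natDegree_le_of_dvd (hpq.symm.dvd_of_dvd_mul_right h1) (mul_ne_zero hq' hB)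
  rwa [natDegree_mul hq' hB, natDegree_expand, mul_comm q.natDegree] at h2

variable {f : SeriesAtInfinity}

/-- The sum `errOrder f p q + q.natDegree` is the order of `f - p / q`. Substitution multiplies it
by `d`, and the factor `A / B` shifts it by `deg B - deg A`. -/
theorem Step.errOrder_eq (hd : 0 < d) (hf : ofPoly B * f = ofPoly A * substPow d hd f)
    (hirr : NotRational f) (h : Step d A B p q p₁ q₁) (hA : A ≠ 0) (hB : B ≠ 0) (hq : q ≠ 0)
    (hq₁ : q₁ ≠ 0) :
    errOrder f p₁ q₁ + q₁.natDegree + A.natDegree =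
      d * (errOrder f p q + q.natDegree) + B.natDegree := by
  have key : ofPoly (expand ℚ d q * B) * (ofPoly q₁ * f - ofPoly p₁) =
      ofPoly (q₁ * A) * substPow d hd (ofPoly q * f - ofPoly p) := by
    have h' := congrArg ofPoly h
    simp only [ofPoly_mul] at h'
    rw [substPow_sub, substPow_mul, substPow_ofPoly, substPow_ofPoly, ofPoly_mul, ofPoly_mul]
    linear_combination (ofPoly (expand ℚ d q) * ofPoly q₁) * hf - h'
  have hq' := expand_ne_zero' hd hq
  have h0 := mul_ne_zero hq' hB
  have h1 := mul_ne_zero hq₁ hA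
  have := congrArg HahnSeries.order key
  rw [HahnSeries.order_mul (ofPoly_ne_zero h0) (hirr.sub_ne_zero p₁ hq₁),
    HahnSeries.order_mul (ofPoly_ne_zero h1) (substPow_ne_zero hd (hirr.sub_ne_zero p hq)),
    order_substPow hd (hirr.sub_ne_zero p hq), order_ofPoly h0, order_ofPoly h1,
    natDegree_mul hq' hB, natDegree_mul hq₁ hA, natDegree_expand] at this
  unfold errOrder
  push_cast at this
  linarith

/-- Every approximation of `f` that is good enough arises from a Padé approximation of
smaller degree. -/
theorem IsPade.step (hd : 0 < d) (hf : ofPoly B * f = ofPoly A * substPow d hd f)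
    (hirr : NotRational f) (hA : A ≠ 0) (hB : B ≠ 0) (hq₁ : q₁ ≠ 0)
    (hgap : (q₁.natDegree + A.natDegree + B.natDegree : ℤ) < errOrder f p₁ q₁)
    (hpade : IsPade f ((q₁.natDegree + A.natDegree) / d) p q) : Step d A B p q p₁ q₁ := by
  unfold Step
  by_contra hne
  set R := q₁ * expand ℚ d p * A - p₁ * expand ℚ d q * B with hR
  have hR0 : R ≠ 0 := _root_.sub_ne_zero.2 (Ne.symm hne)
  have hq := hpade.ne_zero
  have hq' := expand_ne_zero' hd hq
  -- A nonzero polynomial has order at most `0`, while both summands have positive order: the first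
  -- because `d` times the Padé error order exceeds `deg q₁ + deg A`, the second by `hgap`.
  have key : ofPoly R = -(ofPoly (q₁ * A) * substPow d hd (ofPoly q * f - ofPoly p)) +
      ofPoly (expand ℚ d q * B) * (ofPoly q₁ * f - ofPoly p₁) := by
    rw [hR, substPow_sub, substPow_mul, substPow_ofPoly, substPow_ofPoly]
    simp only [ofPoly_mul, ofPoly_sub]
    linear_combination -(ofPoly (expand ℚ d q) * ofPoly q₁) * hf
  have h0 := mul_ne_zero hq' hB
  have h1 := mul_ne_zero hq₁ hA
  have hmin := HahnSeries.min_order_le_order_add (key ▸ ofPoly_ne_zero hR0)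
  rw [← key, HahnSeries.order_neg,
    HahnSeries.order_mul (ofPoly_ne_zero h0) (hirr.sub_ne_zero p₁ hq₁),
    HahnSeries.order_mul (ofPoly_ne_zero h1) (substPow_ne_zero hd (hirr.sub_ne_zero p hq)),
    order_substPow hd (hirr.sub_ne_zero p hq), order_ofPoly h0, order_ofPoly h1, order_ofPoly hR0,
    natDegree_mul hq' hB, natDegree_mul hq₁ hA, natDegree_expand] at hmin
  have hle := hpade.natDegree_le
  have hlt := hpade.lt_errOrder
  unfold errOrder at hgap hlt
  have h2 : q.natDegree * d ≤ q₁.natDegree + A.natDegree := (Nat.le_div_iff_mul_le hd).1 hle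
  have h3 : (q₁.natDegree + A.natDegree : ℤ) < d * (ofPoly q * f - ofPoly p).order := by
    have h4 := Nat.lt_mul_div_succ (q₁.natDegree + A.natDegree) hd
    calc (q₁.natDegree + A.natDegree : ℤ) <
          d * (((q₁.natDegree + A.natDegree) / d : ℕ) + 1 : ℤ) := by exact_mod_cast h4
      _ ≤ _ := by gcongr; omega
  have h5 : ((q.natDegree * d : ℕ) : ℤ) ≤ ((q₁.natDegree + A.natDegree : ℕ) : ℤ) := by
    exact_mod_cast h2
  push_cast at hmin h5
  rcases min_le_iff.1 hmin with h | h <;> omega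

end

/-! ### Eventually periodic integer sequences -/

/-- The sequence `u` is eventually periodic. -/
def EventuallyPeriodic (u : ℕ → ℤ) : Prop := ∃ c > 0, ∃ i₀, ∀ i ≥ i₀, u (i + c) = u i

theorem EventuallyPeriodic.of_eventually_const {u : ℕ → ℤ} {a : ℤ} (h : ∀ᶠ i in atTop, u i = a) :
    EventuallyPeriodic u := by
  obtain ⟨i₀, h⟩ := eventually_atTop.1 h
  exact ⟨1, one_pos, i₀, fun i hi => by rw [h i hi, h (i + 1) (by omega)]⟩

theorem apply_add_mul_eq {u : ℕ → ℤ} {c i₀ : ℕ} (h : ∀ i ≥ i₀, u (i + c) = u i) (k : ℕ) :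
    ∀ i ≥ i₀, u (i + c * k) = u i := by
  induction k with
  | zero => simp
  | succ k ih =>
    intro i hi
    rw [mul_add, mul_one, ← add_assoc, h _ (by omega), ih i hi]

theorem EventuallyPeriodic.add {u v : ℕ → ℤ} (hu : EventuallyPeriodic u)
    (hv : EventuallyPeriodic v) : EventuallyPeriodic fun i => u i + v i := by
  obtain ⟨c, hc, i₀, h⟩ := hu
  obtain ⟨c', hc', i₁, h'⟩ := hv
  refine ⟨c * c', by positivity, max i₀ i₁, fun i hi => ?_⟩
  simp only
  rw [apply_add_mul_eq h c' i (le_trans (le_max_left _ _) hi), mul_comm c c',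
    apply_add_mul_eq h' c i (le_trans (le_max_right _ _) hi)]

theorem EventuallyPeriodic.sum {ι : Type*} (s : Finset ι) {u : ι → ℕ → ℤ}
    (h : ∀ a ∈ s, EventuallyPeriodic (u a)) : EventuallyPeriodic fun i => ∑ a ∈ s, u a i := by
  classical
  induction s using Finset.induction_on with
  | empty => exact ⟨1, one_pos, 0, by simp⟩
  | insert a s ha ih =>
    simp only [Finset.sum_insert ha]
    exact (h a (Finset.mem_insert_self _ _)).add
      (ih fun b hb => h b (Finset.mem_insert_of_mem hb))

/-- The sequence `u` is eventually periodic or diverges to `∞` or to `-∞`. -/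
def Tame (u : ℕ → ℤ) : Prop :=
  EventuallyPeriodic u ∨ Tendsto u atTop atTop ∨ Tendsto u atTop atBot

theorem Tame.of_neg {u : ℕ → ℤ} (h : Tame fun i => -u i) : Tame u := by
  rcases h with ⟨c, hc, i₀, h⟩ | h | h
  · exact Or.inl ⟨c, hc, i₀, fun i hi => neg_injective (h i hi)⟩
  · exact Or.inr (Or.inr (tendsto_neg_atTop_iff.1 h))
  · exact Or.inr (Or.inl (tendsto_neg_atBot_iff.1 h))

/-- The change of the negative part of `n` on adding `r`. -/
def negPartJump (r n : ℤ) : ℤ := max 0 (-(n + r)) - max 0 (-n)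

/-- Far from zero the jump is constant: `0` towards `∞` and `-r` towards `-∞`. -/
theorem Tame.negPartJump {u : ℕ → ℤ} (h : Tame u) (r : ℤ) :
    EventuallyPeriodic fun i => negPartJump r (u i) := by
  rcases h with ⟨c, hc, i₀, h⟩ | h | h
  · exact ⟨c, hc, i₀, fun i hi => by simp only [h i hi]⟩
  · refine EventuallyPeriodic.of_eventually_const (a := 0) ?_
    filter_upwards [h.eventually_ge_atTop |r|] with i hi
    have := neg_abs_le r
    have := abs_nonneg r
    unfold Mahler.negPartJump
    omega
  · refine EventuallyPeriodic.of_eventually_const (a := -r) ?_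
    filter_upwards [h.eventually_le_atBot (-|r|)] with i hi
    have := le_abs_self r
    have := abs_nonneg r
    unfold Mahler.negPartJump
    omega

theorem tendsto_atTop_of_drift {u : ℕ → ℤ} {c i₀ : ℕ} {S : ℤ} (hc : 0 < c) (hS : 0 < S)
    (h : ∀ i ≥ i₀, u (i + c) = u i + S) : Tendsto u atTop atTop := by
  obtain ⟨b, hb⟩ : ∃ b : ℤ, ∀ k < c, b ≤ u (i₀ + k) := by
    obtain ⟨b, hb⟩ := ((Finset.range c).image fun k => u (i₀ + k)).bddBelow
    exact ⟨b, fun k hk => hb (by simpa using ⟨k, hk, rfl⟩)⟩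
  have key : ∀ j k : ℕ, k < c → b + j ≤ u (i₀ + k + c * j) := by
    intro j
    induction j with
    | zero => intro k hk; simpa using hb k hk
    | succ j ih =>
      intro k hk
      rw [mul_add, mul_one, ← add_assoc, h _ (by omega)]
      have := ih k hk
      push_cast
      omega
  refine tendsto_atTop.2 fun C => ?_
  filter_upwards [eventually_ge_atTop (i₀ + c * (C - b).toNat)] with i hi
  have h1 := key ((i - i₀) / c) ((i - i₀) % c) (Nat.mod_lt _ hc)
  rw [add_assoc, Nat.mod_add_div, show i₀ + (i - i₀) = i by omega] at h1
  have h2 : (C - b).toNat ≤ (i - i₀) / c := by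
    rw [Nat.le_div_iff_mul_le hc, mul_comm]; omega
  omega

theorem Tame.of_drift {u : ℕ → ℤ} {c i₀ : ℕ} {S : ℤ} (hc : 0 < c)
    (h : ∀ i ≥ i₀, u (i + c) = u i + S) : Tame u := by
  rcases lt_trichotomy S 0 with hS | rfl | hS
  · refine Tame.of_neg (Or.inr (Or.inl (tendsto_atTop_of_drift (S := -S) (i₀ := i₀) hc
      (by omega) fun i hi => ?_)))
    rw [h i hi]; ring
  · exact Or.inl ⟨c, hc, i₀, fun i hi => by rw [h i hi, add_zero]⟩
  · exact Or.inr (Or.inl (tendsto_atTop_of_drift hc hS h))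

/-- Successive differences are multiplied by `d`, so an initial increase persists. -/
theorem tendsto_atTop_of_affine {u : ℕ → ℤ} {d : ℕ} {e : ℤ} (hd : 0 < d)
    (h : ∀ i, u (i + 1) = d * u i + e) (h0 : u 0 < u 1) : Tendsto u atTop atTop := by
  have hstep : ∀ i, u i + 1 ≤ u (i + 1) := by
    intro i
    induction i with
    | zero => exact h0
    | succ i ih =>
      have h1 : (1 : ℤ) ≤ d := by exact_mod_cast hd
      rw [h (i + 1)]
      conv_lhs => rw [h i]
      nlinarith
  have hlin : ∀ i : ℕ, u 0 + i ≤ u i := by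
    intro i
    induction i with
    | zero => simp
    | succ i ih => have := hstep i; push_cast; omega
  exact tendsto_atTop_mono hlin (tendsto_atTop_add_const_left _ _ tendsto_natCast_atTop_atTop)

theorem Tame.of_affine {u : ℕ → ℤ} {d : ℕ} {e : ℤ} (hd : 0 < d)
    (h : ∀ i, u (i + 1) = d * u i + e) : Tame u := by
  rcases lt_trichotomy (u 0) (u 1) with h0 | h0 | h0
  · exact Or.inr (Or.inl (tendsto_atTop_of_affine hd h h0))
  · refine Or.inl ⟨1, one_pos, 0, fun i _ => ?_⟩
    induction i with
    | zero => exact h0.symm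
    | succ i ih => rw [h (i + 1), ih (by omega), ← h i, ih (by omega)]
  · refine Tame.of_neg (Or.inr (Or.inl (tendsto_atTop_of_affine (e := -e) hd (fun i => ?_) ?_)))
    · rw [h i]; ring
    · omega

/-- A solution of a linear recurrence with eventually periodic inhomogeneity grows like a rational
multiple of `d ^ i`. -/
theorem exists_tendsto_div_pow {D e : ℕ → ℤ} {d : ℕ} (hd : 2 ≤ d)
    (hD : ∀ i, D (i + 1) = d * D i + e i) (he : EventuallyPeriodic e) :
    ∃ l : ℚ, Tendsto (fun i => (D i : ℝ) / (d : ℝ) ^ i) atTop (𝓝 (l : ℝ)) := by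
  obtain ⟨c, hc, i₀, he⟩ := he
  -- Past `i₀` the inhomogeneity cancels in differences over one period, which are therefore
  -- geometric. The value `l` is chosen so that `D i - l * d ^ i` becomes periodic, hence bounded.
  have hu : ∀ k, D (i₀ + k + c) - D (i₀ + k) = d ^ k * (D (i₀ + c) - D i₀) := by
    intro k
    induction k with
    | zero => simp
    | succ k ih =>
      rw [show i₀ + (k + 1) + c = i₀ + k + c + 1 by omega, ← add_assoc, hD, hD,
        he (i₀ + k) (by omega), pow_succ]
      linear_combination (d : ℤ) * ih
  have hd0 : (d : ℚ) ≠ 0 := by positivity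
  have hdc : (d : ℚ) ^ c - 1 ≠ 0 := by
    have : (1 : ℚ) < (d : ℚ) ^ c := one_lt_pow₀ (by exact_mod_cast (by omega : 1 < d)) hc.ne'
    linarith
  set l : ℚ := ((D (i₀ + c) : ℚ) - D i₀) / ((d : ℚ) ^ i₀ * ((d : ℚ) ^ c - 1)) with hl
  refine ⟨l, ?_⟩
  set y : ℕ → ℚ := fun i => D i - l * (d : ℚ) ^ i with hy
  have hper : ∀ i ≥ i₀, y (i + c) = y i := by
    intro i hi
    obtain ⟨k, rfl⟩ := Nat.exists_eq_add_of_le hi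
    have h1 := congrArg (fun z : ℤ => (z : ℚ)) (hu k)
    push_cast at h1
    have h2 : l * ((d : ℚ) ^ i₀ * ((d : ℚ) ^ c - 1)) = (D (i₀ + c) : ℚ) - D i₀ :=
      div_mul_cancel₀ _ (by positivity)
    simp only [hy, pow_add]
    linear_combination h1 - (d : ℚ) ^ k * h2
  obtain ⟨M, hM⟩ : ∃ M : ℚ, ∀ i, |y i| ≤ M := by
    refine ⟨∑ j ∈ Finset.range (i₀ + c), |y j|, fun i => ?_⟩
    induction i using Nat.strong_induction_on with
    | _ i ih =>
      by_cases hi : i < i₀ + c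
      · exact Finset.single_le_sum (f := fun j => |y j|) (fun j _ => abs_nonneg _)
          (Finset.mem_range.2 hi)
      · have := hper (i - c) (by omega)
        rw [show i - c + c = i by omega] at this
        rw [this]
        exact ih (i - c) (by omega)
  have hdR : (1 : ℝ) < d := by exact_mod_cast (by omega : 1 < d)
  have hlim : Tendsto (fun i => (y i : ℝ) / (d : ℝ) ^ i) atTop (𝓝 0) := by
    refine squeeze_zero_norm (a := fun i => (M : ℝ) / (d : ℝ) ^ i) (fun i => ?_)
      ((tendsto_pow_atTop_atTop_of_one_lt hdR).const_div_atTop _)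
    rw [Real.norm_eq_abs, abs_div, abs_of_pos (by positivity : (0 : ℝ) < (d : ℝ) ^ i)]
    gcongr
    exact_mod_cast hM i
  have := hlim.add_const (l : ℝ)
  rw [zero_add] at this
  refine this.congr fun i => ?_
  have : (0 : ℝ) < (d : ℝ) ^ i := by positivity
  simp only [hy]
  push_cast
  field_simp
  ring

/-! ### Zeros and poles along the dynamics -/

section field

variable {K : Type*} [Field K]

/-- The polynomial `X ^ d - γ ^ d` has a simple zero at `γ`: its derivative there is `d * γ ^ (d -
1)`, nonzero in characteristic zero. -/
theorem rootMultiplicity_expand_of_ne_zero [CharZero K] {d : ℕ} (hd : 0 < d) {p : K[X]}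
    (hp : p ≠ 0) {γ : K} (hγ : γ ≠ 0) :
    (expand K d p).rootMultiplicity γ = p.rootMultiplicity (γ ^ d) := by
  obtain ⟨q, hq, hnd⟩ := exists_eq_pow_rootMultiplicity_mul_and_not_dvd p hp (γ ^ d)
  obtain ⟨h, hh⟩ : X - C γ ∣ (X ^ d - C (γ ^ d) : K[X]) := by
    rw [dvd_iff_isRoot]; simp
  have hroot : ¬ (h ^ (p.rootMultiplicity (γ ^ d)) * expand K d q).IsRoot γ := by
    have h1 : h.eval γ ≠ 0 := by
      have hder := congrArg (fun r => (derivative r).eval γ) hh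
      simp only [derivative_sub, derivative_X_pow, derivative_C, derivative_mul, derivative_X,
        eval_sub, eval_mul, eval_add, eval_C, eval_X, eval_pow, eval_one, eval_zero] at hder
      have h3 : (d : K) * γ ^ (d - 1) = eval γ h := by simpa using hder
      rw [← h3]
      simp [hγ, hd.ne']
    have h2 : q.eval (γ ^ d) ≠ 0 := fun h0 => hnd (dvd_iff_isRoot.2 h0)
    simp [IsRoot, expand_eval, h1, h2]
  have hexp : expand K d p = (X - C γ) ^ (p.rootMultiplicity (γ ^ d)) *
      (h ^ (p.rootMultiplicity (γ ^ d)) * expand K d q) := by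
    conv_lhs => rw [hq]
    rw [map_mul, map_pow, map_sub, expand_X, expand_C, hh, mul_pow, mul_assoc]
  have hne : expand K d p ≠ 0 := (expand_ne_zero hd).2 hp
  conv_lhs => rw [hexp]
  rw [rootMultiplicity_mul (hexp ▸ hne), rootMultiplicity_X_sub_C_pow,
    rootMultiplicity_eq_zero hroot, add_zero]

theorem rootMultiplicity_expand_zero {d : ℕ} (hd : 0 < d) {p : K[X]} (hp : p ≠ 0) :
    (expand K d p).rootMultiplicity 0 = d * p.rootMultiplicity 0 := by
  obtain ⟨q, hq, hnd⟩ := exists_eq_pow_rootMultiplicity_mul_and_not_dvd p hp 0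
  have hroot : ¬ (expand K d q).IsRoot 0 := by
    have h2 : q.eval 0 ≠ 0 := fun h0 => hnd (dvd_iff_isRoot.2 h0)
    simpa [IsRoot, expand_eval, hd.ne'] using h2
  have hexp : expand K d p = (X - C 0) ^ (d * p.rootMultiplicity 0) * expand K d q := by
    conv_lhs => rw [hq]
    simp [pow_mul]
  have hne : expand K d p ≠ 0 := (expand_ne_zero hd).2 hp
  conv_lhs => rw [hexp]
  rw [rootMultiplicity_mul (hexp ▸ hne), rootMultiplicity_X_sub_C_pow,
    rootMultiplicity_eq_zero hroot, add_zero]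

/-- The order at `γ` of the rational function `p / q`. -/
def divOrder (p q : K[X]) (γ : K) : ℤ := (p.rootMultiplicity γ : ℤ) - q.rootMultiplicity γ

theorem rootMultiplicity_eq_max_divOrder {p q : K[X]} (h : IsCoprime p q) (hp : p ≠ 0)
    (hq : q ≠ 0) (γ : K) : (q.rootMultiplicity γ : ℤ) = max 0 (-divOrder p q γ) := by
  have : p.rootMultiplicity γ = 0 ∨ q.rootMultiplicity γ = 0 := by
    by_contra! hcon
    have h1 := (rootMultiplicity_pos hp).1 (Nat.pos_of_ne_zero hcon.1)
    have h2 := (rootMultiplicity_pos hq).1 (Nat.pos_of_ne_zero hcon.2)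
    obtain ⟨a, b, hab⟩ := h
    have := congrArg (eval γ) hab
    simp [h1.eq_zero, h2.eq_zero] at this
  unfold divOrder
  omega

/-- Allowing `s` to exceed the root set lets two denominators be compared over a common index set.
-/
theorem natDegree_eq_sum_rootMultiplicity [IsAlgClosed K] {q : K[X]}
    {s : Finset K} (hs : ∀ γ, q.rootMultiplicity γ ≠ 0 → γ ∈ s) :
    (q.natDegree : ℤ) = ∑ γ ∈ s, (q.rootMultiplicity γ : ℤ) := by
  classical
  rw [← (IsAlgClosed.splits q).natDegree_eq_card_roots.symm]
  rw [← Multiset.toFinset_sum_count_eq]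
  push_cast
  simp only [count_roots]
  refine Finset.sum_subset (fun γ hγ => hs γ ?_) (fun γ _ hγ => ?_)
  · rw [← count_roots]
    exact (Multiset.count_pos.2 (Multiset.mem_toFinset.1 hγ)).ne'
  · rw [← count_roots]
    exact_mod_cast Multiset.count_eq_zero.2 fun h => hγ (Multiset.mem_toFinset.2 h)

theorem finite_rootMultiplicity_ne_zero {p : K[X]} (hp : p ≠ 0) :
    {γ : K | p.rootMultiplicity γ ≠ 0}.Finite :=
  (finite_setOfPred_isRoot hp).subset fun _ hγ => (rootMultiplicity_pos hp).1 (Nat.pos_of_ne_zero hγ)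

end field

/-! ### Orders along orbits of `x ↦ x ^ d` and growth of the denominator degree -/

section field

variable {K : Type*} [Field K]

theorem eventually_eq_zero_of_injective {ι : Type*} {x : ℕ → ι} (hx : Function.Injective x)
    {g : ι → ℤ} (hg : {a | g a ≠ 0}.Finite) : ∀ᶠ t in atTop, g (x t) = 0 := by
  have h := hx.tendsto_cofinite.eventually (hg.eventually_cofinite_notMem)
  rw [Nat.cofinite_eq_atTop] at h
  filter_upwards [h] with t ht
  simpa using ht

/-- Along the orbit of a point under `x ↦ x ^ d`, cumulative sums of a finitely supported function
are eventually constant or drift linearly. -/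
theorem tame_sum_orbit {d : ℕ} (δ : K) {n₀ r : K → ℤ} (hn₀ : {a | n₀ a ≠ 0}.Finite)
    (hr : {a | r a ≠ 0}.Finite) :
    Tame fun i => n₀ (δ ^ d ^ i) + ∑ t ∈ Finset.range i, r (δ ^ d ^ t) := by
  set x : ℕ → K := fun t => δ ^ d ^ t with hx
  have hsucc : ∀ t, x (t + 1) = x t ^ d := fun t => by simp only [hx]; rw [pow_succ, pow_mul]
  -- An injective orbit meets the finite supports only finitely often. Any other orbit is eventually
  -- periodic, and each period adds the same amount.
  by_cases hinj : Function.Injective x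
  · obtain ⟨i₀, hi₀⟩ := eventually_atTop.1 ((eventually_eq_zero_of_injective hinj hn₀).and
      (eventually_eq_zero_of_injective hinj hr))
    refine Tame.of_drift (c := 1) (i₀ := i₀) (S := 0) one_pos fun i hi => ?_
    change n₀ (x (i + 1)) + ∑ t ∈ Finset.range (i + 1), r (x t) =
      n₀ (x i) + ∑ t ∈ Finset.range i, r (x t) + 0
    rw [Finset.sum_range_succ, (hi₀ i hi).1, (hi₀ i hi).2, (hi₀ (i + 1) (by omega)).1]
    ring
  · obtain ⟨s, c, hc, hsc⟩ : ∃ s c : ℕ, 0 < c ∧ x (s + c) = x s := by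
      simp only [Function.Injective, not_forall] at hinj
      obtain ⟨a, b, hab, hne⟩ := hinj
      rcases lt_or_gt_of_ne hne with h | h
      · exact ⟨a, b - a, by omega, by rw [show a + (b - a) = b by omega, hab]⟩
      · exact ⟨b, a - b, by omega, by rw [show b + (a - b) = a by omega, hab]⟩
    have hper : ∀ i ≥ s, x (i + c) = x i := by
      intro i hi
      induction i, hi using Nat.le_induction with
      | base => exact hsc
      | succ i hi ih => rw [show i + 1 + c = i + c + 1 by omega, hsucc, hsucc, ih]
    have hsum : ∀ i ≥ s, ∑ k ∈ Finset.range c, r (x (i + k)) =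
        ∑ k ∈ Finset.range c, r (x (s + k)) := by
      intro i hi
      induction i, hi using Nat.le_induction with
      | base => rfl
      | succ i hi ih =>
        rw [← ih]
        have h1 := Finset.sum_range_succ (fun k => r (x (i + k))) c
        have h2 := Finset.sum_range_succ' (fun k => r (x (i + k))) c
        rw [hper i hi] at h1
        simp only [add_zero] at h2
        simp only [add_assoc, add_comm 1]
        linarith
    refine Tame.of_drift (c := c) (i₀ := s) (S := ∑ k ∈ Finset.range c, r (x (s + k))) hc
      fun i hi => ?_
    change n₀ (x (i + c)) + ∑ t ∈ Finset.range (i + c), r (x t) =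
      n₀ (x i) + ∑ t ∈ Finset.range i, r (x t) + _
    rw [hper i hi, Finset.sum_range_add, hsum i hi]
    ring

/-- The degree of the reduced denominator grows like a rational multiple of `d ^ i` along the
iteration `R ↦ (A / B) R(z ^ d)`. -/
theorem exists_tendsto_natDegree_field [IsAlgClosed K] [CharZero K] {d : ℕ} (hd : 2 ≤ d)
    {A B : K[X]} (hA : A ≠ 0) (hB : B ≠ 0) {P Q : ℕ → K[X]} (hP : ∀ i, P i ≠ 0)
    (hQ : ∀ i, Q i ≠ 0) (hcop : ∀ i, IsCoprime (P i) (Q i))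
    (hstep : ∀ i, P (i + 1) * expand K d (Q i) * B = Q (i + 1) * expand K d (P i) * A) :
    ∃ l : ℚ, Tendsto (fun i => ((Q i).natDegree : ℝ) / (d : ℝ) ^ i) atTop (𝓝 (l : ℝ)) := by
  classical
  have hd0 : 0 < d := by omega
  have hE : ∀ {p : K[X]}, p ≠ 0 → expand K d p ≠ 0 := fun h => (expand_ne_zero hd0).2 h
  set r : K → ℤ := divOrder A B
  -- This is the order of the `i`-th fraction after `z ↦ z ^ d`. Multiplication by `A / B` then adds
  -- `r γ`, so pole orders change only on the finite support of `r`; these changes add up to `deg Q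
  -- (i + 1) - d * deg Q i`.
  set m : ℕ → K → ℤ := fun i => divOrder (expand K d (P i)) (expand K d (Q i))
  have hsupp : ∀ {p q : K[X]}, p ≠ 0 → q ≠ 0 → {a | divOrder p q a ≠ 0}.Finite := by
    intro p q hp hq
    refine ((finite_rootMultiplicity_ne_zero hp).union (finite_rootMultiplicity_ne_zero hq)).subset
      fun a ha => ?_
    simp only [Set.mem_union, Set.mem_ofPred_eq]
    by_contra! h
    exact ha (by simp [divOrder, h.1, h.2])
  have hr : {a | r a ≠ 0}.Finite := hsupp hA hB
  have hsuccN : ∀ i γ, divOrder (P (i + 1)) (Q (i + 1)) γ = m i γ + r γ := by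
    intro i γ
    have h1 := mul_ne_zero (hP (i + 1)) (hE (hQ i))
    have h2 := mul_ne_zero (hQ (i + 1)) (hE (hP i))
    have h := congrArg (rootMultiplicity γ) (hstep i)
    rw [rootMultiplicity_mul (mul_ne_zero h1 hB), rootMultiplicity_mul h1,
      rootMultiplicity_mul (mul_ne_zero h2 hA), rootMultiplicity_mul h2] at h
    simp only [m, r, divOrder]
    omega
  have hm_ne : ∀ i γ, γ ≠ 0 → m i γ = divOrder (P i) (Q i) (γ ^ d) := by
    intro i γ hγ
    simp only [m, divOrder]
    rw [rootMultiplicity_expand_of_ne_zero hd0 (hP i) hγ,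
      rootMultiplicity_expand_of_ne_zero hd0 (hQ i) hγ]
  have hm_zero : ∀ i, m i 0 = d * divOrder (P i) (Q i) 0 := by
    intro i
    simp only [m, divOrder]
    rw [rootMultiplicity_expand_zero hd0 (hP i), rootMultiplicity_expand_zero hd0 (hQ i)]
    push_cast; ring
  have hclosed : ∀ i γ, γ ≠ 0 → divOrder (P i) (Q i) γ = divOrder (P 0) (Q 0) (γ ^ d ^ i) +
      ∑ t ∈ Finset.range i, r (γ ^ d ^ t) := by
    intro i
    induction i with
    | zero => intro γ _; simp
    | succ i ih =>
      intro γ hγ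
      rw [hsuccN, hm_ne i γ hγ, ih _ (pow_ne_zero _ hγ), Finset.sum_range_succ', pow_zero, pow_one]
      simp only [pow_succ', pow_mul]
      ring
  have htame : ∀ γ, Tame fun i => m i γ := by
    intro γ
    -- At `0` substitution multiplies orders by `d`; elsewhere it transports them along `γ ↦ γ ^ d`.
    by_cases hγ : γ = 0
    · rw [hγ]
      refine Tame.of_affine (d := d) (e := d * r 0) hd0 fun i => ?_
      rw [hm_zero, hsuccN, mul_add]
    · convert tame_sum_orbit (d := d) (γ ^ d) (hsupp (hP 0) (hQ 0)) hr using 2 with i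
      rw [hm_ne i γ hγ, hclosed i _ (pow_ne_zero _ hγ)]
  refine exists_tendsto_div_pow (D := fun i => ((Q i).natDegree : ℤ)) hd (fun i => ?_)
    (EventuallyPeriodic.sum hr.toFinset fun γ _ => (htame γ).negPartJump (r γ)) |>.imp
    fun l hl => by simpa using hl
  have hcop' : IsCoprime (expand K d (P i)) (expand K d (Q i)) :=
    (hcop i).map (expand K d).toRingHom
  set s : Finset K := (finite_rootMultiplicity_ne_zero (hQ (i + 1))).toFinset ∪
    (finite_rootMultiplicity_ne_zero (hE (hQ i))).toFinset ∪ hr.toFinset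
  have h1 := natDegree_eq_sum_rootMultiplicity (q := Q (i + 1)) (s := s)
    fun γ hγ => by simp only [s, Finset.mem_union, Set.Finite.mem_toFinset, Set.mem_ofPred_eq]; tauto
  have h2 := natDegree_eq_sum_rootMultiplicity (q := expand K d (Q i)) (s := s)
    fun γ hγ => by simp only [s, Finset.mem_union, Set.Finite.mem_toFinset, Set.mem_ofPred_eq]; tauto
  have h3 : ∑ γ ∈ hr.toFinset, negPartJump (r γ) (m i γ) = ∑ γ ∈ s, negPartJump (r γ) (m i γ) := by
    refine Finset.sum_subset (Finset.subset_union_right) fun γ _ hγ => ?_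
    have : r γ = 0 := by simpa using hγ
    simp [negPartJump, this]
  rw [natDegree_expand] at h2
  push_cast at h2
  rw [h1, h3, mul_comm (d : ℤ), h2, ← Finset.sum_add_distrib]
  refine Finset.sum_congr rfl fun γ _ => ?_
  rw [rootMultiplicity_eq_max_divOrder (hcop (i + 1)) (hP _) (hQ _),
    rootMultiplicity_eq_max_divOrder hcop' (hE (hP i)) (hE (hQ i)), hsuccN]
  simp only [negPartJump, m]
  ring

end field

theorem exists_tendsto_natDegree {d : ℕ} (hd : 2 ≤ d) {A B : ℚ[X]} (hA : A ≠ 0) (hB : B ≠ 0)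
    {P Q : ℕ → ℚ[X]} (hP : ∀ i, P i ≠ 0) (hQ : ∀ i, Q i ≠ 0)
    (hcop : ∀ i, IsCoprime (P i) (Q i)) (hstep : ∀ i, Step d A B (P i) (Q i) (P (i + 1)) (Q (i + 1))) :
    ∃ l : ℚ, Tendsto (fun i => ((Q i).natDegree : ℝ) / (d : ℝ) ^ i) atTop (𝓝 (l : ℝ)) := by
  let φ := algebraMap ℚ ℂ
  have hne : ∀ {p : ℚ[X]}, p ≠ 0 → p.map φ ≠ 0 := fun h => (Polynomial.map_ne_zero_iff φ.injective).2 h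
  have := exists_tendsto_natDegree_field (K := ℂ) hd (hne hA) (hne hB)
    (P := fun i => (P i).map φ) (Q := fun i => (Q i).map φ) (fun i => hne (hP i))
    (fun i => hne (hQ i)) (fun i => (hcop i).map (mapRingHom φ)) (fun i => by
      have := congrArg (Polynomial.map φ) (hstep i)
      simpa [Polynomial.map_mul, map_expand] using this)
  simpa [natDegree_map] using this

/-! ### Orbits of approximations -/

section

variable {d : ℕ} {A B p q p₁ q₁ : ℚ[X]} {f : SeriesAtInfinity}

theorem natDegree_eq_of_mul_eq_mul {P Q : ℚ[X]} (h : p * Q = q * P) (hpq : IsCoprime p q)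
    (hPQ : IsCoprime P Q) : q.natDegree = Q.natDegree := by
  have h1 : q ∣ Q := hpq.symm.dvd_of_dvd_mul_left ⟨P, h⟩
  have h2 : Q ∣ q := hPQ.symm.dvd_of_dvd_mul_right ⟨p, by rw [← h, mul_comm]⟩
  exact natDegree_eq_of_degree_eq (degree_eq_degree_of_associated (associated_of_dvd_dvd h1 h2))

theorem errOrder_eq_of_mul_eq_mul (hirr : NotRational f) {P Q : ℚ[X]} (h : p * Q = q * P)
    (hpq : IsCoprime p q) (hPQ : IsCoprime P Q) (hq : q ≠ 0) (hQ : Q ≠ 0) :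
    errOrder f p q = errOrder f P Q := by
  have key : ofPoly Q * (ofPoly q * f - ofPoly p) = ofPoly q * (ofPoly Q * f - ofPoly P) := by
    have := congrArg ofPoly h
    simp only [ofPoly_mul] at this
    linear_combination -this
  have := congrArg HahnSeries.order key
  rw [HahnSeries.order_mul (ofPoly_ne_zero hQ) (hirr.sub_ne_zero p hq),
    HahnSeries.order_mul (ofPoly_ne_zero hq) (hirr.sub_ne_zero P hQ), order_ofPoly hq,
    order_ofPoly hQ, natDegree_eq_of_mul_eq_mul h hpq hPQ] at this
  exact add_left_cancel this

theorem Step.mul_eq_mul (hd : 0 < d) {P Q P₁ Q₁ : ℚ[X]} (h : Step d A B p q p₁ q₁)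
    (h' : Step d A B P Q P₁ Q₁) (hPQ : p * Q = q * P) (hA : A ≠ 0) (hB : B ≠ 0) (hq : q ≠ 0)
    (hP : P ≠ 0) : p₁ * Q₁ = q₁ * P₁ := by
  unfold Step at h h'
  have h1 := congrArg (expand ℚ d) hPQ
  simp only [map_mul] at h1
  have hne : expand ℚ d q * B * expand ℚ d P * A ≠ 0 := mul_ne_zero (mul_ne_zero (mul_ne_zero
    (expand_ne_zero' hd hq) hB) (expand_ne_zero' hd hP)) hA
  apply mul_right_cancel₀ hne
  linear_combination (Q₁ * expand ℚ d P * A) * h - (q₁ * expand ℚ d p * A) * h' +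
    (q₁ * P₁ * A * B) * h1

theorem exists_step (hd : 0 < d) (hA : A ≠ 0) (hB : B ≠ 0) (hp : p ≠ 0) (hq : q ≠ 0) :
    ∃ p₁ q₁ : ℚ[X], p₁ ≠ 0 ∧ q₁ ≠ 0 ∧ IsCoprime p₁ q₁ ∧ Step d A B p q p₁ q₁ := by
  set X := expand ℚ d p * A
  set Y := expand ℚ d q * B
  have hX : X ≠ 0 := mul_ne_zero (expand_ne_zero' hd hp) hA
  have hY : Y ≠ 0 := mul_ne_zero (expand_ne_zero' hd hq) hB
  obtain ⟨p₁, q₁, hp₁, hq₁, h⟩ := extract_gcd X Y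
  refine ⟨p₁, q₁, fun h0 => hX (by rw [hp₁, h0, mul_zero]), fun h0 => hY (by rw [hq₁, h0, mul_zero]),
    (gcd_isUnit_iff _ _).1 h, ?_⟩
  change p₁ * expand ℚ d q * B = q₁ * expand ℚ d p * A
  rw [mul_assoc, mul_assoc]
  change p₁ * Y = q₁ * X
  linear_combination p₁ * hq₁ - q₁ * hp₁

/-- `(P i, Q i)` is an orbit of reduced fractions under `R ↦ (A / B) R(z ^ d)`. -/
structure IsOrbit (d : ℕ) (A B : ℚ[X]) (P Q : ℕ → ℚ[X]) : Prop where
  num_ne_zero : ∀ i, P i ≠ 0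
  den_ne_zero : ∀ i, Q i ≠ 0
  coprime : ∀ i, IsCoprime (P i) (Q i)
  step : ∀ i, Step d A B (P i) (Q i) (P (i + 1)) (Q (i + 1))

theorem exists_isOrbit (hd : 0 < d) (hA : A ≠ 0) (hB : B ≠ 0) (hp : p ≠ 0) (hq : q ≠ 0)
    (hpq : IsCoprime p q) : ∃ P Q : ℕ → ℚ[X], P 0 = p ∧ Q 0 = q ∧ IsOrbit d A B P Q := by
  let T := {x : ℚ[X] × ℚ[X] // x.1 ≠ 0 ∧ x.2 ≠ 0 ∧ IsCoprime x.1 x.2}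
  have hnext : ∀ x : T, ∃ y : T, Step d A B x.1.1 x.1.2 y.1.1 y.1.2 := by
    intro x
    obtain ⟨p₁, q₁, h1, h2, h3, h4⟩ := exists_step hd hA hB x.2.1 x.2.2.1
    exact ⟨⟨(p₁, q₁), h1, h2, h3⟩, h4⟩
  choose next hnext using hnext
  let s : ℕ → T := fun i => next^[i] ⟨(p, q), hp, hq, hpq⟩
  refine ⟨fun i => (s i).1.1, fun i => (s i).1.2, rfl, rfl, fun i => (s i).2.1,
    fun i => (s i).2.2.1, fun i => (s i).2.2.2, fun i => ?_⟩
  have : s (i + 1) = next (s i) := Function.iterate_succ_apply' _ _ _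
  simp only [this]
  exact hnext _

/-- Since `d ≥ 2`, the excess of the denominator degree over `A.natDegree` is multiplied at least by
`d` at each step. -/
theorem IsOrbit.pow_add_le_natDegree {P Q : ℕ → ℚ[X]} (hd : 2 ≤ d) (h : IsOrbit d A B P Q)
    (hA : A ≠ 0) (h0 : A.natDegree < (Q 0).natDegree) (i : ℕ) :
    d ^ i + A.natDegree ≤ (Q i).natDegree := by
  induction i with
  | zero => rw [pow_zero]; omega
  | succ i ih =>
    have h1 := (h.step i).le_natDegree_add (h.coprime i) hA (h.den_ne_zero _)
    have h2 : d * (d ^ i + A.natDegree) ≤ d * (Q i).natDegree := Nat.mul_le_mul_left d ih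
    have h3 : 2 * A.natDegree ≤ d * A.natDegree := Nat.mul_le_mul_right _ hd
    rw [pow_succ']
    rw [mul_add] at h2
    omega

/-- Both `E + D` and `D` are asymptotically rational multiples of `d ^ i`; the bound `D ≥ d ^ i`
keeps the second multiple nonzero, and `E / D = (E + D) / D - 1`. -/
theorem IsOrbit.exists_tendsto {P Q : ℕ → ℚ[X]} (hd : 2 ≤ d) (h : IsOrbit d A B P Q)
    (hf : ofPoly B * f = ofPoly A * substPow d (by omega) f) (hirr : NotRational f)
    (hA : A ≠ 0) (hB : B ≠ 0) (h0 : A.natDegree < (Q 0).natDegree) :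
    ∃ ρ : ℚ, Tendsto (fun i => (errOrder f (P i) (Q i) : ℝ) / (Q i).natDegree) atTop
      (𝓝 (ρ : ℝ)) := by
  obtain ⟨l, hl⟩ := exists_tendsto_natDegree hd hA hB h.num_ne_zero h.den_ne_zero h.coprime h.step
  obtain ⟨s, hs⟩ := exists_tendsto_div_pow
    (D := fun i => errOrder f (P i) (Q i) + (Q i).natDegree)
    (e := fun _ => (B.natDegree : ℤ) - A.natDegree) hd (fun i => by
      have := (h.step i).errOrder_eq (by omega) hf hirr hA hB (h.den_ne_zero _) (h.den_ne_zero _)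
      linarith) ⟨1, one_pos, 0, fun _ _ => rfl⟩
  have hd0 : ∀ i : ℕ, (0 : ℝ) < (d : ℝ) ^ i := fun i => by
    have : (0 : ℝ) < d := by exact_mod_cast (by omega : 0 < d)
    positivity
  have hl1 : (1 : ℝ) ≤ l := by
    refine ge_of_tendsto' hl fun i => ?_
    rw [one_le_div (hd0 i)]
    have := h.pow_add_le_natDegree hd hA h0 i
    exact_mod_cast (by omega : d ^ i ≤ (Q i).natDegree)
  refine ⟨s / l - 1, ?_⟩
  have := (hs.div hl (by linarith)).sub_const 1
  push_cast
  refine this.congr fun i => ?_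
  have h1 : (0 : ℝ) < (Q i).natDegree := by
    have := h.pow_add_le_natDegree hd hA h0 i
    have : 0 < d ^ i := by positivity
    exact_mod_cast (by omega : 0 < (Q i).natDegree)
  have := hd0 i
  simp only [Pi.div_apply]
  push_cast
  field_simp
  ring

/-- Approximations whose error order exceeds the degree by a positive proportion lie on the orbits
of finitely many Padé approximations. -/
theorem exists_orbit_of_large_gap (hd : 2 ≤ d)
    (hf : ofPoly B * f = ofPoly A * substPow d (by omega) f) (hirr : NotRational f)
    (hA : A ≠ 0) (hB : B ≠ 0) {pn qn : ℕ → ℚ[X]} (hpade : ∀ n, IsPade f n (pn n) (qn n))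
    {P Q : ℕ → ℕ → ℚ[X]} (hP : ∀ n, P n 0 = pn n) (hQ : ∀ n, Q n 0 = qn n)
    (horb : ∀ n, A.natDegree < (qn n).natDegree → IsOrbit d A B (P n) (Q n))
    {ε : ℝ} (hε : 0 < ε) :
    ∃ M : ℕ, ∀ p q : ℚ[X], q ≠ 0 → IsCoprime p q → M < q.natDegree →
      (1 + ε) * q.natDegree < errOrder f p q →
      ∃ n ≤ M, A.natDegree < (qn n).natDegree ∧ ∃ i, p * Q n i = q * P n i := by
  set κ := A.natDegree + B.natDegree with hκ
  -- The first bound forces the Padé predecessor to have degree above `A.natDegree`; the second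
  -- makes the gap large enough for `IsPade.step`.
  obtain ⟨M₀, hM₀κ, hM₀⟩ : ∃ M₀ : ℕ, (d + 2) * κ ≤ M₀ ∧ 2 * (κ : ℝ) ≤ ε * (M₀ - κ) := by
    obtain ⟨M₁, hM₁⟩ := exists_nat_ge (2 * (κ : ℝ) / ε + κ)
    refine ⟨max M₁ ((d + 2) * κ), le_max_right _ _, ?_⟩
    have h1 : 2 * (κ : ℝ) / ε ≤ (max M₁ ((d + 2) * κ) : ℕ) - (κ : ℝ) := by
      have : (M₁ : ℝ) ≤ (max M₁ ((d + 2) * κ) : ℕ) := by exact_mod_cast le_max_left _ _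
      linarith
    rw [div_le_iff₀ hε] at h1
    linarith
  have hdR : (2 : ℝ) ≤ d := by exact_mod_cast hd
  -- The shifts by `κ` make the gap condition inductive: for the predecessor, `D - κ` is at most its
  -- old value divided by `d`, and `E - D + κ` is at least its old value divided by `d`.
  suffices H : ∀ D : ℕ, ∀ p q : ℚ[X], q.natDegree = D → q ≠ 0 → IsCoprime p q → M₀ < D →
      ε * (D - κ) < errOrder f p q - D + κ →
      ∃ n ≤ M₀ + κ, A.natDegree < (qn n).natDegree ∧ ∃ i, p * Q n i = q * P n i by
    refine ⟨M₀ + κ, fun p q hq hpq hM hgap => H _ p q rfl hq hpq (by omega) ?_⟩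
    have : (0 : ℝ) ≤ κ := by positivity
    nlinarith
  intro D
  induction D using Nat.strong_induction_on with
  | _ D ih =>
  intro p q hD hq hpq hM hgap
  have hMD : (M₀ : ℝ) ≤ D := by exact_mod_cast hM.le
  have hgap1 : (q.natDegree + A.natDegree + B.natDegree : ℤ) < errOrder f p q := by
    have h1 : (D : ℝ) + κ < errOrder f p q := by nlinarith
    rw [hD]
    have h2 : ((D + κ : ℕ) : ℤ) < errOrder f p q := by exact_mod_cast h1
    rw [hκ] at h2
    push_cast at h2
    linarith
  set n := (q.natDegree + A.natDegree) / d with hn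
  have hstep := IsPade.step (by omega) hf hirr hA hB hq hgap1 (hpade n)
  have hq' := (hpade n).ne_zero
  have h1 := hstep.le_natDegree_add (hpade n).coprime hA hq
  have h2 := hstep.natDegree_le (by omega) hpq hB hq'
  have h3 := hstep.errOrder_eq (by omega) hf hirr hA hB hq' hq
  rw [hD] at h1 h2 h3
  set D' := (qn n).natDegree
  have hAD : A.natDegree < D' := by
    by_contra hcon
    have : d * D' ≤ d * κ := Nat.mul_le_mul_left d (by omega)
    have : (d + 2) * κ = d * κ + 2 * κ := by ring
    omega
  have horb' := horb n hAD
  have hsame : ∀ m i, IsOrbit d A B (P m) (Q m) → pn n * Q m i = qn n * P m i →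
      p * Q m (i + 1) = q * P m (i + 1) := fun m i hm h =>
    hstep.mul_eq_mul (by omega) (hm.step i) h hA hB hq' (hm.num_ne_zero i)
  by_cases hD' : M₀ < D'
  · have hlt : D' < D := by
      have : 2 * D' ≤ d * D' := Nat.mul_le_mul_right _ hd
      have : κ ≤ M₀ := le_trans (Nat.le_mul_of_pos_left _ (by omega)) hM₀κ
      omega
    obtain ⟨m, hm, hAm, i, hi⟩ := ih D' hlt (pn n) (qn n) rfl hq' (hpade n).coprime hD' (by
      have h1R : (d : ℝ) * D' ≤ D + A.natDegree := by exact_mod_cast h1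
      have h3R : (errOrder f p q : ℝ) + D + A.natDegree =
          d * (errOrder f (pn n) (qn n) + D') + B.natDegree := by exact_mod_cast h3
      have hκR : (κ : ℝ) = A.natDegree + B.natDegree := by rw [hκ]; push_cast; ring
      have hA0 : (0 : ℝ) ≤ A.natDegree := by positivity
      have hB0 : (0 : ℝ) ≤ B.natDegree := by positivity
      have hκ0 : (0 : ℝ) ≤ κ := by positivity
      have h4 : (d : ℝ) * (D' - κ) ≤ D - κ := by nlinarith
      have h5 : (errOrder f p q : ℝ) - D + κ ≤ d * (errOrder f (pn n) (qn n) - D' + κ) := by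
        nlinarith
      have h6 : (d : ℝ) * (ε * (D' - κ)) < d * (errOrder f (pn n) (qn n) - D' + κ) := by
        nlinarith
      exact lt_of_mul_lt_mul_left h6 (by linarith))
    exact ⟨m, hm, hAm, i + 1, hsame m i (horb m hAm) hi⟩
  · refine ⟨n, ?_, hAD, 1, hsame n 0 horb' (by rw [hP, hQ, mul_comm])⟩
    rw [hn, hD]
    apply Nat.div_le_of_le_mul
    have : d * D' ≤ d * M₀ := Nat.mul_le_mul_left d (by omega)
    have : κ ≤ d * κ := Nat.le_mul_of_pos_left _ (by omega)
    have : d * (M₀ + κ) = d * M₀ + d * κ := by ring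
    omega

/-- The function-field analogue of the irrationality exponent is rational: the limit superior of
the ratios of error orders and degrees over all reduced approximations, or `1`. -/
theorem exists_rat_exponent (hd : 2 ≤ d)
    (hf : ofPoly B * f = ofPoly A * substPow d (by omega) f) (hirr : NotRational f)
    (hA : A ≠ 0) (hB : B ≠ 0) :
    ∃ ρ : ℚ, 1 ≤ ρ ∧
      (∀ δ : ℝ, 0 < δ → ∃ N : ℕ, ∀ p q : ℚ[X], q ≠ 0 → IsCoprime p q → N ≤ q.natDegree →
        (errOrder f p q : ℝ) ≤ (ρ + δ) * q.natDegree) ∧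
      (ρ = 1 ∨ ∀ δ : ℝ, 0 < δ → ∀ N : ℕ, ∃ p q : ℚ[X], q ≠ 0 ∧ IsCoprime p q ∧
        N ≤ q.natDegree ∧ (ρ - δ) * q.natDegree ≤ errOrder f p q) := by
  choose pn qn hpade using exists_isPade hirr
  have horb : ∀ n, ∃ P Q : ℕ → ℚ[X], P 0 = pn n ∧ Q 0 = qn n ∧
      (A.natDegree < (qn n).natDegree → IsOrbit d A B P Q) := by
    intro n
    by_cases h : A.natDegree < (qn n).natDegree
    · have hp : pn n ≠ 0 := by
        intro h0
        have := (hpade n).coprime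
        rw [h0, isCoprime_zero_left] at this
        rw [natDegree_eq_zero_of_isUnit this] at h
        omega
      obtain ⟨P, Q, hP, hQ, h'⟩ :=
        exists_isOrbit (d := d) (by omega) hA hB hp (hpade n).ne_zero (hpade n).coprime
      exact ⟨P, Q, hP, hQ, fun _ => h'⟩
    · exact ⟨fun _ => pn n, fun _ => qn n, rfl, rfl, fun h' => absurd h' h⟩
  choose P Q hP hQ horb using horb
  have hlim : ∀ n, ∃ ρ : ℚ, A.natDegree < (qn n).natDegree →
      Tendsto (fun i => (errOrder f (P n i) (Q n i) : ℝ) / (Q n i).natDegree) atTop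
        (𝓝 (ρ : ℝ)) := by
    intro n
    by_cases h : A.natDegree < (qn n).natDegree
    · obtain ⟨ρ, hρ⟩ := (horb n h).exists_tendsto hd hf hirr hA hB (by rwa [hQ])
      exact ⟨ρ, fun _ => hρ⟩
    · exact ⟨0, fun h' => absurd h' h⟩
  choose ρ hρ using hlim
  have hdeg : ∀ n i, A.natDegree < (qn n).natDegree → i < (Q n i).natDegree := by
    intro n i h
    have := (horb n h).pow_add_le_natDegree hd hA (by rwa [hQ]) i
    have := Nat.lt_pow_self (n := i) (by omega : 1 < d)
    omega
  -- The finite set `S` depends on `ε` alone, so one maximum over it can serve for every `δ`.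
  have hup : ∀ ε : ℝ, 0 < ε → ∃ S : Finset ℕ, (∀ n ∈ S, A.natDegree < (qn n).natDegree) ∧
      ∀ L : ℝ, (∀ n ∈ S, (ρ n : ℝ) ≤ L) → ∀ δ : ℝ, 0 < δ → 1 + ε ≤ L + δ → ∃ N : ℕ,
        ∀ p q : ℚ[X], q ≠ 0 → IsCoprime p q → N ≤ q.natDegree →
          (errOrder f p q : ℝ) ≤ (L + δ) * q.natDegree := by
    intro ε hε
    obtain ⟨M, hM⟩ := exists_orbit_of_large_gap hd hf hirr hA hB hpade hP hQ horb hε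
    refine ⟨(Finset.range (M + 1)).filter fun n => A.natDegree < (qn n).natDegree,
      fun n hn => (Finset.mem_filter.1 hn).2, fun L hL δ hδ hLδ => ?_⟩
    set S := (Finset.range (M + 1)).filter fun n => A.natDegree < (qn n).natDegree
    have hev : ∀ᶠ i in atTop, ∀ n ∈ S,
        (errOrder f (P n i) (Q n i) : ℝ) / (Q n i).natDegree < L + δ := by
      rw [Filter.eventually_all_finset]
      intro n hn
      exact (hρ n (Finset.mem_filter.1 hn).2).eventually_lt_const (by linarith [hL n hn])
    obtain ⟨i₀, hi₀⟩ := eventually_atTop.1 hev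
    refine ⟨M + 1 + ∑ n ∈ S, ∑ i ∈ Finset.range i₀, ((Q n i).natDegree + 1),
      fun p q hq hpq hN => ?_⟩
    by_cases hgap : (1 + ε) * q.natDegree < errOrder f p q
    · obtain ⟨n, hn, hAn, i, hi⟩ := hM p q hq hpq (by omega) hgap
      have hnS : n ∈ S := Finset.mem_filter.2 ⟨Finset.mem_range.2 (by omega), hAn⟩
      have ho := horb n hAn
      rw [errOrder_eq_of_mul_eq_mul hirr hi hpq (ho.coprime i) hq (ho.den_ne_zero i)]
      rw [natDegree_eq_of_mul_eq_mul hi hpq (ho.coprime i)] at hN ⊢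
      have hi' : i₀ ≤ i := by
        by_contra hcon
        have h1 := Finset.single_le_sum (f := fun i => (Q n i).natDegree + 1)
          (fun _ _ => Nat.zero_le _) (Finset.mem_range.2 (not_le.1 hcon))
        have h2 := Finset.single_le_sum
          (f := fun n => ∑ i ∈ Finset.range i₀, ((Q n i).natDegree + 1))
          (fun _ _ => Nat.zero_le _) hnS
        omega
      have h3 : (0 : ℝ) < (Q n i).natDegree := by exact_mod_cast (by have := hdeg n i hAn; omega)
      exact ((div_lt_iff₀ h3).1 (hi₀ i hi' n hnS)).le
    · exact (not_lt.1 hgap).trans (by gcongr)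
  by_cases hbig : ∃ n, A.natDegree < (qn n).natDegree ∧ 1 < ρ n
  · obtain ⟨n₁, hn₁, h1⟩ := hbig
    have h1R : (1 : ℝ) < ρ n₁ := by exact_mod_cast h1
    -- With this `ε`, approximations of large degree and quality above `ρ n₁` lie on orbits indexed
    -- by `S`, so the maximum over `insert n₁ S` is the exponent.
    obtain ⟨S, hS, hS'⟩ := hup (ρ n₁ - 1) (by linarith)
    obtain ⟨n, hn, hmax⟩ := Finset.exists_max_image (insert n₁ S) ρ (Finset.insert_nonempty _ _)
    have hn' : A.natDegree < (qn n).natDegree := by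
      rcases Finset.mem_insert.1 hn with rfl | h
      · exact hn₁
      · exact hS n h
    have h2 : ρ n₁ ≤ ρ n := hmax n₁ (Finset.mem_insert_self _ _)
    have h2R : (ρ n₁ : ℝ) ≤ ρ n := by exact_mod_cast h2
    refine ⟨ρ n, by linarith, fun δ hδ => hS' (ρ n) (fun m hm => ?_) δ hδ (by linarith),
      Or.inr fun δ hδ N => ?_⟩
    · exact_mod_cast hmax m (Finset.mem_insert_of_mem hm)
    · obtain ⟨i, hi, hiN⟩ := (((hρ n hn').eventually_const_lt
        (by linarith : (ρ n : ℝ) - δ < ρ n)).and (eventually_ge_atTop N)).exists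
      have h3 := hdeg n i hn'
      have h4 : (0 : ℝ) < (Q n i).natDegree := by exact_mod_cast (by omega)
      exact ⟨P n i, Q n i, (horb n hn').den_ne_zero i, (horb n hn').coprime i, by omega,
        ((lt_div_iff₀ h4).1 hi).le⟩
  · push Not at hbig
    refine ⟨1, le_rfl, fun δ hδ => ?_, Or.inl rfl⟩
    obtain ⟨S, hS, hS'⟩ := hup δ hδ
    exact hS' _ (fun n hn => by exact_mod_cast hbig n (hS n hn)) δ hδ (by simp)

end

/-! ### Logarithmic growth rates -/

/-- `log |u m|` grows like `κ L d ^ m`. -/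
def HasRate (L : ℝ) (d : ℕ) (u : ℕ → ℝ) (κ : ℝ) : Prop :=
  Tendsto (fun m => Real.log |u m| / (L * (d : ℝ) ^ m)) atTop (𝓝 κ)

section rates

variable {L : ℝ} {d : ℕ} {u v : ℕ → ℝ} {κ η : ℝ}

theorem tendsto_mul_pow_atTop (hL : 0 < L) (hd : 2 ≤ d) :
    Tendsto (fun m => L * (d : ℝ) ^ m) atTop atTop :=
  (tendsto_pow_atTop_atTop_of_one_lt
    (by exact_mod_cast (by omega : 1 < d) : (1 : ℝ) < d)).const_mul_atTop hL

theorem HasRate.mul (hu : HasRate L d u κ) (hv : HasRate L d v η) (hu0 : ∀ᶠ m in atTop, u m ≠ 0)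
    (hv0 : ∀ᶠ m in atTop, v m ≠ 0) : HasRate L d (fun m => u m * v m) (κ + η) := by
  refine (Tendsto.add hu hv).congr' ?_
  filter_upwards [hu0, hv0] with m h1 h2
  rw [abs_mul, Real.log_mul (abs_ne_zero.2 h1) (abs_ne_zero.2 h2), add_div]

theorem HasRate.const (hL : 0 < L) (hd : 2 ≤ d) (c : ℝ) : HasRate L d (fun _ => c) 0 :=
  (tendsto_mul_pow_atTop hL hd).const_div_atTop _

/-- The limit is the fixed point of `s ↦ (s + κ) / d`, which contracts distances at least by half.
-/
theorem tendsto_of_recurrence {s c : ℕ → ℝ} (hd : 2 ≤ d) (hs : ∀ m, s (m + 1) = (s m + c m) / d)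
    (hc : Tendsto c atTop (𝓝 κ)) : Tendsto s atTop (𝓝 (κ / (d - 1))) := by
  have hd2 : (2 : ℝ) ≤ d := by exact_mod_cast hd
  have hd1 : (d : ℝ) - 1 ≠ 0 := by linarith
  set e : ℕ → ℝ := fun m => s m - κ / (d - 1) with he
  have hrec : ∀ m, e (m + 1) = (e m + (c m - κ)) / d := by
    intro m
    simp only [he]
    rw [hs]
    field_simp
    ring
  have hhalf : ∀ m, |e (m + 1)| ≤ (|e m| + |c m - κ|) / 2 := by
    intro m
    rw [hrec, abs_div, abs_of_pos (by linarith : (0 : ℝ) < d)]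
    exact div_le_div₀ (by positivity) (abs_add_le _ _) (by norm_num) hd2
  suffices Tendsto e atTop (𝓝 0) by
    have := this.add_const (κ / (d - 1))
    simpa [he] using this
  rw [Metric.tendsto_atTop]
  intro ε hε
  obtain ⟨M, hM⟩ := Metric.tendsto_atTop.1 hc (ε / 2) (by linarith)
  have hb : ∀ k, |e (M + k)| ≤ ε / 2 + |e M| * (1 / 2) ^ k := by
    intro k
    induction k with
    | zero => simp; linarith
    | succ k ih =>
      have h1 := hhalf (M + k)
      have h2 := hM (M + k) (by omega)
      rw [Real.dist_eq] at h2
      rw [← add_assoc, pow_succ]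
      linarith
  have hlim : Tendsto (fun k : ℕ => |e M| * (1 / 2 : ℝ) ^ k) atTop (𝓝 (|e M| * 0)) :=
    (tendsto_pow_atTop_nhds_zero_of_lt_one (by norm_num) (by norm_num)).const_mul _
  rw [mul_zero] at hlim
  obtain ⟨k₀, hk₀⟩ := eventually_atTop.1 (hlim.eventually_lt_const (by linarith : 0 < ε / 2))
  refine ⟨M + k₀, fun n hn => ?_⟩
  obtain ⟨k, rfl⟩ := Nat.exists_eq_add_of_le (by omega : M ≤ n)
  have := hb k
  have := hk₀ k (by omega)
  rw [Real.dist_eq, sub_zero]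
  linarith

theorem HasRate.prod (hL : 0 < L) (hd : 2 ≤ d) (hu : HasRate L d u κ) (hu0 : ∀ m, u m ≠ 0) :
    HasRate L d (fun m => ∏ t ∈ Finset.range m, u t) (κ / (d - 1)) := by
  refine tendsto_of_recurrence hd (fun m => ?_) hu
  have hd0 : (d : ℝ) ≠ 0 := by positivity
  simp only
  rw [Finset.prod_range_succ, abs_mul, Real.log_mul (abs_ne_zero.2 (Finset.prod_ne_zero_iff.2
    fun t _ => hu0 t)) (abs_ne_zero.2 (hu0 m)), pow_succ]
  field_simp

theorem HasRate.eventually_lt (hL : 0 < L) (hd : 2 ≤ d) (hu : HasRate L d u κ) (h : κ < η) :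
    ∀ᶠ m in atTop, Real.log |u m| < η * (L * (d : ℝ) ^ m) := by
  filter_upwards [Tendsto.eventually_lt_const h hu] with m hm
  have : (0 : ℝ) < d := by exact_mod_cast (by omega : 0 < d)
  exact (div_lt_iff₀ (by positivity)).1 hm

theorem HasRate.eventually_gt (hL : 0 < L) (hd : 2 ≤ d) (hu : HasRate L d u κ) (h : η < κ) :
    ∀ᶠ m in atTop, η * (L * (d : ℝ) ^ m) < Real.log |u m| := by
  filter_upwards [Tendsto.eventually_const_lt h hu] with m hm
  have : (0 : ℝ) < d := by exact_mod_cast (by omega : 0 < d)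
  exact (lt_div_iff₀ (by positivity)).1 hm

end rates

/-! ### Rational approximations to a real number -/

/-- The rational approximations to `ξ` of quality `μ`. -/
def approxSet (ξ μ : ℝ) : Set ℚ := {x : ℚ | |ξ - (x : ℝ)| < (x.den : ℝ) ^ (-μ)}

theorem den_le_abs {P Q : ℤ} (hQ : Q ≠ 0) {x : ℚ} (hx : x * Q = P) : (x.den : ℝ) ≤ |(Q : ℝ)| := by
  have h1 : x = Rat.divInt P Q := by
    rw [Rat.divInt_eq_div]
    have : (Q : ℚ) ≠ 0 := by exact_mod_cast hQ
    field_simp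
    exact hx
  have h2 : (x.den : ℤ) ∣ Q := h1 ▸ Rat.den_dvd P Q
  have h3 := Int.le_of_dvd (abs_pos.2 hQ) ((dvd_abs _ _).2 h2)
  exact_mod_cast h3

/-- The fraction `P m / Q m` misses `ξ` by about `exp (-(κ + η) L d ^ m)`, with denominator at most
about `exp (κ L d ^ m)`; possible cancellation only helps as `μ ≥ 0`. Finitely many fractions cannot
suffice, since the distances to the irrational `ξ` are positive and tend to zero. -/
theorem infinite_approxSet {L ξ : ℝ} {d : ℕ} (hL : 0 < L) (hd : 2 ≤ d) (hξ : Irrational ξ)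
    {P Q : ℕ → ℤ} {κ η μ : ℝ} (hκ : 0 < κ) (hμ0 : 0 ≤ μ) (hμ : μ * κ < κ + η)
    (hQ : HasRate L d (fun m => Q m) κ) (hP : HasRate L d (fun m => Q m * ξ - P m) (-η)) :
    (approxSet ξ μ).Infinite := by
  obtain ⟨θ, hθ1, hθ2⟩ := exists_between hμ
  have hd0 : (0 : ℝ) < d := by exact_mod_cast (by omega : 0 < d)
  have hQ0 : ∀ᶠ m in atTop, Q m ≠ 0 := by
    filter_upwards [hQ.eventually_gt hL hd hκ] with m hm h0
    simp [h0] at hm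
  have hne : ∀ t : ℚ, 0 < |ξ - t| := fun t => abs_pos.2 (sub_ne_zero.2 (hξ.ne_rat t))
  have hlog : ∀ m, Q m ≠ 0 → Real.log |ξ - ((P m / Q m : ℚ) : ℝ)| =
      Real.log |Q m * ξ - P m| - Real.log |(Q m : ℝ)| := by
    intro m hm
    have hm' : (Q m : ℝ) ≠ 0 := by exact_mod_cast hm
    have h1 : (Q m : ℝ) * ξ - P m = Q m * (ξ - ((P m / Q m : ℚ) : ℝ)) := by
      push_cast; field_simp
    rw [h1, abs_mul, Real.log_mul (abs_ne_zero.2 hm') (hne _).ne']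
    ring
  have hθ0 : 0 < θ := (mul_nonneg hμ0 hκ.le).trans_lt hθ1
  obtain ⟨σ, hσ1, hσ2⟩ := exists_between (show θ - η < κ by linarith)
  have hsmall : ∀ᶠ m in atTop, Real.log |ξ - ((P m / Q m : ℚ) : ℝ)| <
      -θ * (L * (d : ℝ) ^ m) := by
    filter_upwards [hQ0, hQ.eventually_gt hL hd hσ2,
      hP.eventually_lt hL hd (show -η < σ - θ by linarith)] with m h0 h1 h2
    rw [hlog m h0]
    linarith
  have hmem : ∀ᶠ m in atTop, (P m / Q m : ℚ) ∈ approxSet ξ μ := by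
    rcases hμ0.eq_or_lt with rfl | hμpos
    · filter_upwards [hsmall] with m hm
      simp only [approxSet, Set.mem_ofPred_eq, neg_zero, Real.rpow_zero]
      rw [← Real.log_neg_iff (hne _)]
      have : 0 < θ * (L * (d : ℝ) ^ m) := by positivity
      linarith
    · filter_upwards [hQ0, hsmall, hQ.eventually_lt hL hd
        (show κ < θ / μ by rw [lt_div_iff₀ hμpos]; linarith)] with m h0 h1 h2
      have hQm : (Q m : ℚ) ≠ 0 := by exact_mod_cast h0
      have hden := den_le_abs (P := P m) h0 (div_mul_cancel₀ _ hQm)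
      have hdpos : (0 : ℝ) < (P m / Q m : ℚ).den := by exact_mod_cast Rat.den_pos _
      simp only [approxSet, Set.mem_ofPred_eq]
      rw [← Real.log_lt_log_iff (hne _) (Real.rpow_pos_of_pos hdpos _), Real.log_rpow hdpos]
      have h3 := Real.log_le_log hdpos hden
      have h4 : μ * Real.log |(Q m : ℝ)| < μ * (θ / μ * (L * (d : ℝ) ^ m)) := by gcongr
      have h5 : μ * (θ / μ * (L * (d : ℝ) ^ m)) = θ * (L * (d : ℝ) ^ m) := by field_simp
      nlinarith
  intro hfin
  have hclose : ∀ᶠ m in atTop, ∀ t ∈ approxSet ξ μ, |ξ - ((P m / Q m : ℚ) : ℝ)| < |ξ - t| := by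
    rw [Filter.eventually_all_finite hfin]
    intro t _
    have h1 := ((tendsto_mul_pow_atTop hL hd).const_mul_atTop hθ0).eventually_gt_atTop
      (-Real.log |ξ - t|)
    filter_upwards [hsmall, h1] with m h2 h3
    rw [← Real.log_lt_log_iff (hne _) (hne _)]
    linarith
  obtain ⟨m, h1, h2⟩ := (hmem.and hclose).exists
  exact lt_irrefl _ (h2 _ h1)

theorem finite_setOf_den_le (ξ X : ℝ) : {x : ℚ | |ξ - (x : ℝ)| < 1 ∧ (x.den : ℝ) ≤ X}.Finite := by
  set M : ℤ := ⌈(|ξ| + 1) * |X|⌉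
  have hfin : (Set.Icc (-M) M ×ˢ Set.Icc (0 : ℤ) ⌈X⌉).Finite :=
    (Set.finite_Icc _ _).prod (Set.finite_Icc _ _)
  refine (hfin.image fun a : ℤ × ℤ => (a.1 / a.2 : ℚ)).subset ?_
  rintro x ⟨h1, h2⟩
  refine ⟨(x.num, x.den), ⟨?_, ?_⟩, by simpa using Rat.num_div_den x⟩
  · simp only [Set.mem_Icc]
    rw [← abs_le]
    have h3 : |(x : ℝ)| ≤ |ξ| + 1 := by
      have := abs_sub_abs_le_abs_sub (x : ℝ) ξ
      rw [abs_sub_comm] at this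
      linarith
    have h4 : |(x.num : ℝ)| = |(x : ℝ)| * x.den := by
      have : (x.num : ℝ) = x * x.den := by exact_mod_cast (Rat.mul_den_eq_num x).symm
      rw [this, abs_mul, Nat.abs_cast]
    have h5 : |(x.num : ℝ)| ≤ M := by
      rw [h4]
      refine le_trans ?_ (Int.le_ceil _)
      have := le_abs_self X
      gcongr
      linarith
    exact_mod_cast h5
  · simp only [Set.mem_Icc]
    refine ⟨by positivity, ?_⟩
    have : ((x.den : ℤ) : ℝ) ≤ (⌈X⌉ : ℝ) := by simpa using h2.trans (Int.le_ceil X)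
    exact_mod_cast this

/-- A family of sequences of good approximations, dense enough in the logarithmic scale, bounds the
quality of all rational approximations. -/
theorem finite_approxSet {L ξ α β lam μ : ℝ} {d : ℕ} (hL : Real.log 2 ≤ L) (hd : 2 ≤ d)
    (hξ : Irrational ξ) (hα : 0 ≤ α) {D : ℕ → ℕ} {E : ℕ → ℤ} {P Q : ℕ → ℕ → ℤ}
    (hD : ∀ n, D n ≤ n) (hE : ∀ n : ℕ, (n : ℤ) < E n) (hQ0 : ∀ n, ∀ᶠ m in atTop, Q n m ≠ 0)
    (hQ : ∀ n, HasRate L d (fun m => Q n m) (D n + β))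
    (hP : ∀ n, HasRate L d (fun m => Q n m * ξ - P n m) (-E n + α))
    (hden : ∀ n, ∀ᶠ m in atTop, ∀ x : ℚ, x * Q n m = P n m →
      (D n - α - 1) * (L * (d : ℝ) ^ m) ≤ Real.log x.den)
    {N₀ : ℕ} (hlam : ∀ n, N₀ ≤ D n → (E n : ℝ) ≤ lam * D n) (hlam1 : 1 ≤ lam)
    (hμ : 1 + lam < μ) : (approxSet ξ μ).Finite := by
  have hlog2 : 0 < Real.log 2 := Real.log_pos (by norm_num)
  have hL0 : 0 < L := hlog2.trans_le hL
  have hd2 : (2 : ℝ) ≤ d := by exact_mod_cast hd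
  obtain ⟨c, hc⟩ := exists_nat_ge (α + 1)
  -- The second condition will force `N₀ ≤ D n`, the third refutes the case `x ≠ P n m / Q n m`, and
  -- the fourth the case of equality.
  obtain ⟨N, hN0, hN1, hN2, hN3⟩ : ∃ N : ℕ, (0 : ℝ) < N ∧ N₀ + β + 1 ≤ (N : ℝ) ∧
      c + β + 3 ≤ (μ - 2) * N ∧ μ * (α + 1) + β + 2 ≤ (μ - 1 - lam) * (N - β - 1) := by
    have h1 : Tendsto (fun N : ℕ => (μ - 2) * (N : ℝ)) atTop atTop :=
      tendsto_natCast_atTop_atTop.const_mul_atTop (by linarith)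
    have h2 : Tendsto (fun N : ℕ => (μ - 1 - lam) * ((N : ℝ) + (-β - 1))) atTop atTop :=
      (tendsto_atTop_add_const_right _ _ tendsto_natCast_atTop_atTop).const_mul_atTop (by linarith)
    obtain ⟨N, h3, h4, h5, h6⟩ := ((tendsto_natCast_atTop_atTop (R := ℝ)).eventually_gt_atTop 0 |>.and
      ((tendsto_natCast_atTop_atTop.eventually_ge_atTop (N₀ + β + 1)).and
      ((h1.eventually_ge_atTop (c + β + 3)).and
      (h2.eventually_ge_atTop (μ * (α + 1) + β + 2))))).exists
    exact ⟨N, h3, h4, h5, by linarith⟩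
  -- Only finitely many `n` occur, so all the asymptotic estimates hold from a common `m₀` on.
  have hev : ∀ᶠ m in atTop, ∀ n ∈ Finset.range (N * d + c + 1), Q n m ≠ 0 ∧
      Real.log |(Q n m : ℝ)| < (D n + β + 1) * (L * (d : ℝ) ^ m) ∧
      Real.log |Q n m * ξ - P n m| < (-E n + α + 1 / 2) * (L * (d : ℝ) ^ m) ∧
      (-E n + α - 1) * (L * (d : ℝ) ^ m) < Real.log |Q n m * ξ - P n m| ∧
      ∀ x : ℚ, x * Q n m = P n m → (D n - α - 1) * (L * (d : ℝ) ^ m) ≤ Real.log x.den := by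
    rw [Filter.eventually_all_finset]
    intro n _
    filter_upwards [hQ0 n, (hQ n).eventually_lt hL0 hd (lt_add_one _),
      (hP n).eventually_lt hL0 hd (lt_add_of_pos_right _ one_half_pos),
      (hP n).eventually_gt hL0 hd (sub_one_lt _), hden n] with m h1 h2 h3 h4 h5
    exact ⟨h1, h2, h3, h4, h5⟩
  obtain ⟨m₀, hm₀⟩ := eventually_atTop.1 hev
  refine (finite_setOf_den_le ξ (Real.exp (N * (L * (d : ℝ) ^ m₀)))).subset fun x hx => ?_
  have hx' : |ξ - x| < (x.den : ℝ) ^ (-μ) := hx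
  have hden1 : (1 : ℝ) ≤ x.den := by exact_mod_cast x.den_pos
  have hden0 : (0 : ℝ) < x.den := by linarith
  refine ⟨hx'.trans_le (Real.rpow_le_one_of_one_le_of_nonpos hden1 (by linarith)), ?_⟩
  by_contra hbig
  rw [not_le, ← Real.lt_log_iff_exp_lt hden0] at hbig
  set H := Real.log x.den / L with hH
  have hHL : Real.log x.den = H * L := by rw [hH]; field_simp
  have hHN : (d : ℝ) ^ m₀ < H / N := by
    rw [lt_div_iff₀ hN0, hH, lt_div_iff₀ hL0]
    linarith
  -- This scale brings the logarithmic height `y` of `x`, in units of `L * d ^ m`, into `[N, N *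
  -- d]`. The index `n` is then taken just above `y`, with a margin `c` absorbing `α`.
  obtain ⟨m, hm1, hm2⟩ := exists_nat_pow_near
    ((one_le_pow₀ (by linarith : (1 : ℝ) ≤ d)).trans hHN.le) (by linarith : (1 : ℝ) < d)
  have hmm : m₀ ≤ m := by
    have := (pow_lt_pow_iff_right₀ (by linarith : (1 : ℝ) < d)).1 (hHN.trans hm2)
    omega
  set Δ := (d : ℝ) ^ m with hΔ
  have hΔ1 : 1 ≤ Δ := one_le_pow₀ (by linarith)
  have hΔ0 : 0 < Δ := by linarith
  set y := H / Δ with hy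
  have hHy : H = y * Δ := by rw [hy]; field_simp
  have hyN : (N : ℝ) ≤ y := by
    rw [hy, le_div_iff₀ hΔ0]
    rw [le_div_iff₀ hN0] at hm1
    linarith
  have hyd : y ≤ (N * d : ℕ) := by
    rw [hy, div_le_iff₀ hΔ0]
    rw [div_lt_iff₀ hN0, pow_succ] at hm2
    push_cast
    linarith
  have hy0 : 0 < y := hN0.trans_le hyN
  set n := ⌈y⌉₊ + c with hn
  have hn1 : y + c ≤ n := by
    rw [hn]; push_cast
    linarith [Nat.le_ceil y]
  have hn2 : (n : ℝ) < y + 1 + c := by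
    rw [hn]; push_cast
    linarith [Nat.ceil_lt_add_one hy0.le]
  have hnr : n ∈ Finset.range (N * d + c + 1) := by
    have := Nat.ceil_le.2 hyd
    rw [Finset.mem_range]; omega
  obtain ⟨hQm, hb, ha1, ha2, hcden⟩ := hm₀ m hmm n hnr
  set h := L * Δ with hh
  have hLh : L ≤ h := le_mul_of_one_le_right hL0.le hΔ1
  have hh0 : 0 < h := hL0.trans_le hLh
  have hDn : (D n : ℝ) ≤ n := by exact_mod_cast hD n
  have hEn : (n : ℝ) + 1 ≤ E n := by exact_mod_cast hE n
  have hlogden : Real.log x.den = y * h := by rw [hHL, hHy, hh]; ring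
  have hQR : (Q n m : ℝ) ≠ 0 := by exact_mod_cast hQm
  have hQpos : 0 < |(Q n m : ℝ)| := abs_pos.2 hQR
  have hξx : 0 < |ξ - x| := abs_pos.2 (sub_ne_zero.2 (hξ.ne_rat x))
  have hxlog : Real.log |ξ - x| < -μ * (y * h) := by
    rw [← hlogden, ← Real.log_rpow hden0]
    exact Real.log_lt_log hξx hx'
  -- If `x` is the approximant itself, `hcden` limits the cancellation in its denominator and `E n ≤
  -- lam * D n` limits its quality.
  by_cases hcase : x * Q n m = P n m
  · have h1 := hcden x hcase
    have h2 := (Real.log_le_log hden0 (den_le_abs hQm hcase)).trans_lt hb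
    rw [hlogden] at h1 h2
    have h1' := le_of_mul_le_mul_right h1 hh0
    have h2' := lt_of_mul_lt_mul_right h2 hh0.le
    have h3 : (N₀ : ℝ) ≤ D n := by linarith
    have h4 := hlam n (by exact_mod_cast h3)
    have h5 : (Q n m : ℝ) * ξ - P n m = Q n m * (ξ - x) := by
      have : (x : ℝ) * Q n m = P n m := by exact_mod_cast hcase
      linear_combination this
    rw [h5, abs_mul, Real.log_mul hQpos.ne' hξx.ne'] at ha2
    have h6 : (-E n + α - 1 - (D n + β + 1)) * h < -μ * y * h := by linarith
    have h6' := lt_of_mul_lt_mul_right h6 hh0.le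
    have h7 := mul_le_mul_of_nonneg_left h1' (by linarith : 0 ≤ μ)
    have h8 := mul_le_mul_of_nonneg_left (by linarith : N - β - 1 ≤ (D n : ℝ))
      (by linarith : 0 ≤ μ - 1 - lam)
    linarith
  -- Otherwise `x.num * Q n m - P n m * x.den` is a nonzero integer. The approximant's error
  -- accounts for less than `1 / 2` of it, so `x.den * |Q n m| * |ξ - x| > 1 / 2`.
  · have hP0 : 0 < |(Q n m : ℝ) * ξ - P n m| := by
      refine abs_pos.2 fun h0 => hξ.ne_rat (P n m / Q n m) ?_
      push_cast
      field_simp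
      linarith
    have h1 : Real.log (|(Q n m : ℝ) * ξ - P n m| * x.den) < Real.log (1 / 2) := by
      rw [Real.log_mul hP0.ne' hden0.ne', hlogden, one_div, Real.log_inv]
      have : (-E n + α + 1 / 2) * h ≤ (-y - 1) * h := by gcongr; linarith
      linarith
    have h2 := (Real.log_lt_log_iff (by positivity) (by norm_num)).1 h1
    have h3 : (1 : ℝ) ≤ |(x.num : ℝ) * Q n m - P n m * x.den| := by
      have : x.num * Q n m - P n m * x.den ≠ 0 := by
        intro h0
        apply hcase
        have h4 : (x.num : ℚ) * Q n m - P n m * x.den = 0 := by exact_mod_cast h0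
        rw [← Rat.mul_den_eq_num x] at h4
        have h5 : (x.den : ℚ) ≠ 0 := by exact_mod_cast x.den_ne_zero
        apply mul_right_cancel₀ h5
        linear_combination h4
      exact_mod_cast Int.one_le_abs this
    have h4 : (x.num : ℝ) * Q n m - P n m * x.den =
        -(x.den * (Q n m * (ξ - x))) + ((Q n m : ℝ) * ξ - P n m) * x.den := by
      have : (x.num : ℝ) = x * x.den := by exact_mod_cast (Rat.mul_den_eq_num x).symm
      rw [this]; ring
    rw [h4] at h3
    have h5 := h3.trans (abs_add_le _ _)
    rw [abs_neg, abs_mul, abs_mul, abs_mul, Nat.abs_cast] at h5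
    have h6 : 1 / 2 < (x.den : ℝ) * (|(Q n m : ℝ)| * |ξ - x|) := by linarith
    have h7 := Real.log_lt_log (by norm_num) h6
    rw [one_div, Real.log_inv, Real.log_mul hden0.ne' (by positivity),
      Real.log_mul hQpos.ne' hξx.ne', hlogden] at h7
    have h8 : (μ * y) * h < (y + (D n + β + 1) + 1) * h := by linarith
    have h8' := lt_of_mul_lt_mul_right h8 hh0.le
    have h9 := mul_le_mul_of_nonneg_left hyN (by linarith : 0 ≤ μ - 2)
    linarith

/-! ### Evaluation of the approximations -/

theorem aeval_map_intCast (p : ℤ[X]) (x : ℤ) :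
    Polynomial.aeval (x : ℝ) (p.map (Int.castRingHom ℚ)) = ((p.eval x : ℤ) : ℝ) := by
  rw [aeval_def, eval₂_map,
    Subsingleton.elim ((algebraMap ℚ ℝ).comp (Int.castRingHom ℚ)) (Int.castRingHom ℝ)]
  exact eval₂_at_apply (Int.castRingHom ℝ) x

theorem exists_int_map (p : ℚ[X]) : ∃ c : ℤ, c ≠ 0 ∧ ∃ p' : ℤ[X],
    p'.map (Int.castRingHom ℚ) = C (c : ℚ) * p := by
  obtain ⟨c, hc0, hc⟩ := IsLocalization.integerNormalization_spec (nonZeroDivisors ℤ) p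
  refine ⟨c, nonZeroDivisors.ne_zero hc0,
    IsLocalization.integerNormalization (nonZeroDivisors ℤ) p, hc.trans ?_⟩
  rw [← smul_eq_C_mul, Int.cast_smul_eq_zsmul]

/-- The hypotheses on a Mahler function and a point that are used in the estimates: `x m` is the
point `b ^ d ^ m` and `F m` is the value of `f` there. -/
structure Evaluation (d : ℕ) (A B : ℤ[X]) (f : SeriesAtInfinity) (b : ℤ) (F : ℕ → ℝ) : Prop where
  two_le : 2 ≤ d
  two_le_abs : 2 ≤ |b|
  eval_num_ne_zero : ∀ m, A.eval (b ^ d ^ m) ≠ 0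
  eval_den_ne_zero : ∀ m, B.eval (b ^ d ^ m) ≠ 0
  exists_hasVal : ∃ r v : ℝ, 0 < r ∧ r ≤ |(b : ℝ)| ∧ HasVal f r v
  hasVal : ∀ m, HasVal f ((b ^ d ^ m : ℤ) : ℝ) (F m)
  value_succ : ∀ m, ((B.eval (b ^ d ^ m) : ℤ) : ℝ) * F m = A.eval (b ^ d ^ m) * F (m + 1)

/-- The product of the values of `P` at the first `m` points `b ^ d ^ t`. -/
def orbitProd (d : ℕ) (b : ℤ) (P : ℤ[X]) (m : ℕ) : ℤ := ∏ t ∈ Finset.range m, P.eval (b ^ d ^ t)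

namespace Evaluation

variable {d : ℕ} {A B : ℤ[X]} {f : SeriesAtInfinity} {b : ℤ} {F : ℕ → ℝ}

theorem two_le_abs_cast (h : Evaluation d A B f b F) : 2 ≤ |(b : ℝ)| := by
  exact_mod_cast h.two_le_abs

theorem log_two_le (h : Evaluation d A B f b F) : Real.log 2 ≤ Real.log |(b : ℝ)| :=
  Real.log_le_log (by norm_num) h.two_le_abs_cast

theorem log_pos (h : Evaluation d A B f b F) : 0 < Real.log |(b : ℝ)| :=
  (Real.log_pos (by norm_num)).trans_le h.log_two_le

theorem tendsto_abs (h : Evaluation d A B f b F) :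
    Tendsto (fun m => |((b ^ d ^ m : ℤ) : ℝ)|) atTop atTop := by
  have h1 := (tendsto_pow_atTop_atTop_of_one_lt (by linarith [h.two_le_abs_cast] :
    1 < |(b : ℝ)|)).comp (tendsto_pow_atTop_atTop_of_one_lt (by have := h.two_le; omega : 1 < d))
  refine h1.congr fun m => ?_
  simp [abs_pow]

theorem log_abs_pow (m : ℕ) :
    Real.log |((b ^ d ^ m : ℤ) : ℝ)| = Real.log |(b : ℝ)| * (d : ℝ) ^ m := by
  push_cast
  rw [abs_pow, Real.log_pow]
  push_cast
  ring

theorem point_ne_zero (h : Evaluation d A B f b F) (m : ℕ) : ((b ^ d ^ m : ℤ) : ℝ) ≠ 0 := by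
  have : b ≠ 0 := by
    rintro rfl
    have := h.two_le_abs
    simp at this
  exact_mod_cast pow_ne_zero _ this

/-- A convergent nonzero series has growth rate `-order` along the points `b ^ d ^ m`. -/
theorem hasRate_of_hasVal (h : Evaluation d A B f b F) {g : SeriesAtInfinity} (hg : g ≠ 0)
    {r v : ℝ} (hr : 0 < r) (hv : HasVal g r v) {w : ℕ → ℝ}
    (hw : ∀ m, HasVal g ((b ^ d ^ m : ℤ) : ℝ) (w m)) :
    HasRate (Real.log |(b : ℝ)|) d w (-g.order) ∧ ∀ᶠ m in atTop, w m ≠ 0 := by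
  have hc : (g.coeff g.order : ℝ) ≠ 0 := by
    exact_mod_cast mt HahnSeries.coeff_order_eq_zero.1 hg
  have hlim := hv.tendsto_mul_pow_order hr h.tendsto_abs hw
  have hne : ∀ᶠ m in atTop, w m ≠ 0 := by
    filter_upwards [hlim.eventually_ne hc] with m hm h0
    simp [h0] at hm
  refine ⟨?_, hne⟩
  have h1 := ((Real.continuousAt_log (abs_ne_zero.2 hc)).tendsto.comp hlim.abs).div_atTop
    (tendsto_mul_pow_atTop h.log_pos h.two_le)
  have h2 := h1.add_const (-(g.order : ℝ))
  rw [zero_add] at h2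
  refine h2.congr' ?_
  filter_upwards [hne] with m hm
  have h3 := h.log_pos
  have h4 : (0 : ℝ) < (d : ℝ) ^ m := by
    have : (0 : ℝ) < d := by exact_mod_cast (by have := h.two_le; omega : 0 < d)
    positivity
  simp only [Function.comp_apply]
  rw [abs_mul, Real.log_mul (abs_ne_zero.2 hm)
    (abs_ne_zero.2 (zpow_ne_zero _ (h.point_ne_zero m))), abs_zpow, Real.log_zpow, log_abs_pow]
  field_simp
  ring

theorem hasRate_eval (h : Evaluation d A B f b F) {P : ℤ[X]} (hP : P ≠ 0) :
    HasRate (Real.log |(b : ℝ)|) d (fun m => ((P.eval (b ^ d ^ m) : ℤ) : ℝ)) P.natDegree ∧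
      ∀ᶠ m in atTop, ((P.eval (b ^ d ^ m) : ℤ) : ℝ) ≠ 0 := by
  have hP' : P.map (Int.castRingHom ℚ) ≠ 0 :=
    (Polynomial.map_ne_zero_iff Int.cast_injective).2 hP
  have := h.hasRate_of_hasVal (ofPoly_ne_zero hP') one_pos (HasVal.polynomial one_ne_zero _)
    (w := fun m => ((P.eval (b ^ d ^ m) : ℤ) : ℝ)) fun m => by
      rw [← aeval_map_intCast]
      exact HasVal.polynomial (h.point_ne_zero m) _
  rw [order_ofPoly hP', natDegree_map_eq_of_injective Int.cast_injective] at this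
  simpa using this

theorem hasRate_orbitProd (h : Evaluation d A B f b F) {P : ℤ[X]}
    (hP : ∀ m, P.eval (b ^ d ^ m) ≠ 0) :
    HasRate (Real.log |(b : ℝ)|) d (fun m => (orbitProd d b P m : ℝ))
      (P.natDegree / (d - 1)) := by
  have hP0 : P ≠ 0 := by
    rintro rfl
    exact hP 0 (by simp)
  have := (h.hasRate_eval hP0).1.prod h.log_pos h.two_le fun m => by exact_mod_cast hP m
  simpa [orbitProd] using this

theorem orbitProd_ne_zero {P : ℤ[X]} (hP : ∀ m, P.eval (b ^ d ^ m) ≠ 0) (m : ℕ) :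
    orbitProd d b P m ≠ 0 := Finset.prod_ne_zero_iff.2 fun t _ => hP t

theorem orbitProd_mul_value (h : Evaluation d A B f b F) (m : ℕ) :
    (orbitProd d b B m : ℝ) * F 0 = orbitProd d b A m * F m := by
  induction m with
  | zero => simp [orbitProd]
  | succ m ih =>
    unfold orbitProd at ih ⊢
    rw [Finset.prod_range_succ, Finset.prod_range_succ]
    push_cast at ih ⊢
    have := h.value_succ m
    linear_combination ((B.eval (b ^ d ^ m) : ℤ) : ℝ) * ih +
      (∏ t ∈ Finset.range m, ((A.eval (b ^ d ^ t) : ℤ) : ℝ)) * this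

/-- The denominators of the approximations to `f b` obtained from a rational approximation to
`f`. -/
def approxDen (d : ℕ) (b : ℤ) (B q : ℤ[X]) (m : ℕ) : ℤ := q.eval (b ^ d ^ m) * orbitProd d b B m

variable {p q : ℤ[X]}

theorem hasRate_approxDen (h : Evaluation d A B f b F) (hq : q ≠ 0) :
    HasRate (Real.log |(b : ℝ)|) d (fun m => (approxDen d b B q m : ℝ))
      (q.natDegree + B.natDegree / (d - 1)) := by
  have hrate := h.hasRate_eval hq
  have := hrate.1.mul (h.hasRate_orbitProd h.eval_den_ne_zero) hrate.2
    (Eventually.of_forall fun m => by exact_mod_cast orbitProd_ne_zero h.eval_den_ne_zero m)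
  simpa [approxDen] using this

theorem approxDen_ne_zero (h : Evaluation d A B f b F) (hq : q ≠ 0) :
    ∀ᶠ m in atTop, approxDen d b B q m ≠ 0 := by
  filter_upwards [(h.hasRate_eval hq).2] with m hm
  exact mul_ne_zero (by exact_mod_cast hm) (orbitProd_ne_zero h.eval_den_ne_zero m)

/-- By `orbitProd_mul_value` the linear form is the product of the values of `A` times `q f - p`
evaluated at `b ^ d ^ m`; the factors contribute `α` and `-E`. -/
theorem hasRate_error (h : Evaluation d A B f b F) (hf : NotRational f) (hq : q ≠ 0) :
    HasRate (Real.log |(b : ℝ)|) d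
      (fun m => (approxDen d b B q m : ℝ) * F 0 - approxDen d b A p m)
      (-(errOrder f (p.map (Int.castRingHom ℚ)) (q.map (Int.castRingHom ℚ)) : ℝ) +
        A.natDegree / (d - 1)) := by
  have hq' : q.map (Int.castRingHom ℚ) ≠ 0 :=
    (Polynomial.map_ne_zero_iff Int.cast_injective).2 hq
  obtain ⟨r, v, hr, -, hv⟩ := h.exists_hasVal
  have hrate := h.hasRate_of_hasVal (hf.sub_ne_zero (p.map (Int.castRingHom ℚ)) hq') hr
    ((hv.polynomial_mul hr.ne' _).sub (HasVal.polynomial hr.ne' _))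
    (w := fun m => ((q.eval (b ^ d ^ m) : ℤ) : ℝ) * F m - p.eval (b ^ d ^ m)) fun m => by
      rw [← aeval_map_intCast, ← aeval_map_intCast]
      exact ((h.hasVal m).polynomial_mul (h.point_ne_zero m) _).sub
        (HasVal.polynomial (h.point_ne_zero m) _)
  have := hrate.1.mul (h.hasRate_orbitProd h.eval_num_ne_zero) hrate.2
    (Eventually.of_forall fun m => by exact_mod_cast orbitProd_ne_zero h.eval_num_ne_zero m)
  unfold errOrder
  convert this using 2 with m
  have := h.orbitProd_mul_value m
  unfold approxDen
  push_cast
  linear_combination ((q.eval (b ^ d ^ m) : ℤ) : ℝ) * this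

theorem exists_bezout (hpq : IsCoprime (p.map (Int.castRingHom ℚ)) (q.map (Int.castRingHom ℚ))) :
    ∃ (U V : ℤ[X]) (K : ℤ), K ≠ 0 ∧ U * p + V * q = C K := by
  obtain ⟨u, v, huv⟩ := hpq
  obtain ⟨c, hc, U, hU⟩ := exists_int_map u
  obtain ⟨e, he, V, hV⟩ := exists_int_map v
  refine ⟨C e * U, C c * V, c * e, mul_ne_zero hc he, ?_⟩
  apply Polynomial.map_injective (Int.castRingHom ℚ) Int.cast_injective
  simp only [Polynomial.map_add, Polynomial.map_mul, hU, hV, Polynomial.map_C,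
    Int.coe_castRingHom, C_mul]
  linear_combination (C (c : ℚ) * C (e : ℚ)) * huv

/-- Evaluating a Bézout identity `U p + V q = K` shows that the value of `q` divides `K` times the
product of values of `A` times `x.den`. Thus cancellation costs the denominator only a rate
independent of `q`. -/
theorem exists_abs_eval_le (h : Evaluation d A B f b F)
    (hpq : IsCoprime (p.map (Int.castRingHom ℚ)) (q.map (Int.castRingHom ℚ))) :
    ∃ K : ℝ, 0 < K ∧ ∀ m, ∀ x : ℚ, x * approxDen d b B q m = approxDen d b A p m →
      |((q.eval (b ^ d ^ m) : ℤ) : ℝ)| ≤ K * |(orbitProd d b A m : ℝ)| * x.den := by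
  obtain ⟨U, V, K, hK, hUV⟩ := exists_bezout hpq
  refine ⟨|(K : ℝ)|, abs_pos.2 (by exact_mod_cast hK), fun m x hx => ?_⟩
  have hbez := congrArg (eval (b ^ d ^ m)) hUV
  simp only [eval_add, eval_mul, eval_C] at hbez
  set y := b ^ d ^ m
  have hA := orbitProd_ne_zero h.eval_num_ne_zero m
  have hB := orbitProd_ne_zero h.eval_den_ne_zero m
  have hx' : x.num * (q.eval y * orbitProd d b B m) = p.eval y * orbitProd d b A m * x.den := by
    unfold approxDen at hx
    have h1 := Rat.mul_den_eq_num x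
    have h2 : (x.num : ℚ) * (q.eval y * orbitProd d b B m : ℤ) =
        (p.eval y * orbitProd d b A m : ℤ) * x.den := by
      rw [← h1, ← hx]; ring
    exact_mod_cast h2
  have hdvd : q.eval y ∣ K * orbitProd d b A m * x.den := by
    refine ⟨U.eval y * x.num * orbitProd d b B m + V.eval y * orbitProd d b A m * x.den, ?_⟩
    linear_combination (U.eval y) * (-hx') - (orbitProd d b A m * x.den) * hbez
  have hne : K * orbitProd d b A m * x.den ≠ 0 :=
    mul_ne_zero (mul_ne_zero hK hA) (by exact_mod_cast x.den_ne_zero)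
  have hle := Int.le_of_dvd (abs_pos.2 hne) ((abs_dvd_abs _ _).2 hdvd)
  rw [abs_mul, abs_mul, Nat.abs_cast] at hle
  exact_mod_cast hle

theorem eventually_le_log_den (h : Evaluation d A B f b F) (hq : q ≠ 0)
    (hpq : IsCoprime (p.map (Int.castRingHom ℚ)) (q.map (Int.castRingHom ℚ))) :
    ∀ᶠ m in atTop, ∀ x : ℚ, x * approxDen d b B q m = approxDen d b A p m →
      (q.natDegree - A.natDegree / (d - 1) - 1 : ℝ) * (Real.log |(b : ℝ)| * (d : ℝ) ^ m) ≤
        Real.log x.den := by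
  obtain ⟨K, hK, hle⟩ := h.exists_abs_eval_le hpq
  have h1 := h.hasRate_eval hq
  have h2 := (h.hasRate_orbitProd h.eval_num_ne_zero)
  filter_upwards [h1.2, h1.1.eventually_gt h.log_pos h.two_le (sub_lt_self _ one_half_pos),
    h2.eventually_lt h.log_pos h.two_le (lt_add_of_pos_right _ (by norm_num : (0 : ℝ) < 1 / 4)),
    (HasRate.const h.log_pos h.two_le K).eventually_lt h.log_pos h.two_le
      (by norm_num : (0 : ℝ) < 1 / 4)] with m h3 h4 h5 h6 x hx
  have hA : (orbitProd d b A m : ℝ) ≠ 0 := by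
    exact_mod_cast orbitProd_ne_zero h.eval_num_ne_zero m
  have hx0 : (x.den : ℝ) ≠ 0 := by exact_mod_cast x.den_ne_zero
  have h7 := Real.log_le_log (abs_pos.2 h3) (hle m x hx)
  rw [abs_of_pos hK] at h6
  rw [Real.log_mul (by positivity) hx0, Real.log_mul hK.ne' (abs_ne_zero.2 hA)] at h7
  linarith

end Evaluation

/-! ### The irrationality exponent -/

theorem exists_int_pair {f : SeriesAtInfinity} (hirr : NotRational f) {p q : ℚ[X]} (hq : q ≠ 0)
    (hpq : IsCoprime p q) : ∃ p' q' : ℤ[X], q' ≠ 0 ∧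
      IsCoprime (p'.map (Int.castRingHom ℚ)) (q'.map (Int.castRingHom ℚ)) ∧
      q'.natDegree = q.natDegree ∧
      errOrder f (p'.map (Int.castRingHom ℚ)) (q'.map (Int.castRingHom ℚ)) = errOrder f p q := by
  obtain ⟨c, hc, p', hp'⟩ := exists_int_map p
  obtain ⟨e, he, q', hq'⟩ := exists_int_map q
  have hcQ : (c : ℚ) ≠ 0 := by exact_mod_cast hc
  have heQ : (e : ℚ) ≠ 0 := by exact_mod_cast he
  have h1 : (C e * p').map (Int.castRingHom ℚ) = C (c * e : ℚ) * p := by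
    rw [Polynomial.map_mul, hp', Polynomial.map_C, Int.coe_castRingHom, C_mul]; ring
  have h2 : (C c * q').map (Int.castRingHom ℚ) = C (c * e : ℚ) * q := by
    rw [Polynomial.map_mul, hq', Polynomial.map_C, Int.coe_castRingHom, C_mul]; ring
  have hunit : IsUnit (C (c * e : ℚ)) := isUnit_C.2 (IsUnit.mk0 _ (mul_ne_zero hcQ heQ))
  have hcop : IsCoprime (C (c * e : ℚ) * p) (C (c * e : ℚ) * q) :=
    (isCoprime_mul_unit_left hunit p q).2 hpq
  have hq0 : C (c * e : ℚ) * q ≠ 0 := mul_ne_zero hunit.ne_zero hq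
  refine ⟨C e * p', C c * q', ?_, ?_, ?_, ?_⟩
  · intro h0
    rw [h0, Polynomial.map_zero] at h2
    exact hq0 h2.symm
  · rw [h1, h2]; exact hcop
  · rw [← natDegree_map_eq_of_injective (f := Int.castRingHom ℚ) Int.cast_injective, h2,
      natDegree_C_mul (mul_ne_zero hcQ heQ)]
  · rw [h1, h2]
    exact errOrder_eq_of_mul_eq_mul hirr (by ring) hcop hpq hq0 hq

theorem le_irrationalityExponent {ξ μ : ℝ} (h : (approxSet ξ μ).Infinite) :
    (μ : EReal) ≤ irrationalityExponent ξ :=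
  le_sSup ⟨μ, h, rfl⟩

theorem two_le_irrationalityExponent {ξ : ℝ} (hξ : Irrational ξ) :
    ((2 : ℝ) : EReal) ≤ irrationalityExponent ξ := by
  apply le_irrationalityExponent
  refine (Real.infinite_rat_abs_sub_lt_one_div_den_sq_of_irrational hξ).mono fun x hx => ?_
  simp only [approxSet, Set.mem_ofPred_eq] at hx ⊢
  rw [Real.rpow_neg (by positivity)]
  simpa using hx

theorem Evaluation.exists_rat_irrationalityExponent {d : ℕ} {A B : ℤ[X]} {f : SeriesAtInfinity}
    {b : ℤ} {F : ℕ → ℝ} (h : Evaluation d A B f b F) (hd0 : 0 < d)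
    (hf : ofPoly (B.map (Int.castRingHom ℚ)) * f =
      ofPoly (A.map (Int.castRingHom ℚ)) * substPow d hd0 f)
    (hirr : NotRational f) (hξ : Irrational (F 0)) :
    ∃ ρ : ℚ, irrationalityExponent (F 0) = ((ρ : ℝ) : EReal) := by
  have hne : ∀ {P : ℤ[X]}, P.eval (b ^ d ^ 0) ≠ 0 → P.map (Int.castRingHom ℚ) ≠ 0 := by
    intro P hP
    refine (Polynomial.map_ne_zero_iff Int.cast_injective).2 ?_
    rintro rfl
    simp at hP
  obtain ⟨ρ, hρ1, hup, hlow⟩ := exists_rat_exponent h.two_le hf hirr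
    (hne (h.eval_num_ne_zero 0)) (hne (h.eval_den_ne_zero 0))
  have hρR : (1 : ℝ) ≤ ρ := by exact_mod_cast hρ1
  set α : ℝ := A.natDegree / ((d : ℝ) - 1)
  set β : ℝ := B.natDegree / ((d : ℝ) - 1)
  have hd1 : (0 : ℝ) < (d : ℝ) - 1 := by
    have : (2 : ℝ) ≤ d := by exact_mod_cast h.two_le
    linarith
  have hα : 0 ≤ α := by positivity
  have hβ : 0 ≤ β := by positivity
  refine ⟨1 + ρ, le_antisymm (sSup_le ?_) ?_⟩
  · rintro _ ⟨μ, hμ, rfl⟩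
    rw [EReal.coe_le_coe_iff]
    by_contra hcon
    push_cast at hcon
    -- Half of the excess of `μ` over `1 + ρ` goes into `lam`, which leaves `1 + lam < μ`.
    obtain ⟨N₀, hN₀⟩ := hup ((μ - 1 - ρ) / 2) (by linarith)
    have hpair : ∀ n : ℕ, ∃ p q : ℤ[X], q ≠ 0 ∧
        IsCoprime (p.map (Int.castRingHom ℚ)) (q.map (Int.castRingHom ℚ)) ∧ q.natDegree ≤ n ∧
        (n : ℤ) < errOrder f (p.map (Int.castRingHom ℚ)) (q.map (Int.castRingHom ℚ)) := by
      intro n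
      obtain ⟨p, q, hpade⟩ := exists_isPade hirr n
      obtain ⟨p', q', h1, h2, h3, h4⟩ := exists_int_pair hirr hpade.ne_zero hpade.coprime
      exact ⟨p', q', h1, h2, h3 ▸ hpade.natDegree_le, h4 ▸ hpade.lt_errOrder⟩
    choose p q hq hpq hdeg hord using hpair
    refine hμ (finite_approxSet (lam := ρ + (μ - 1 - ρ) / 2) (β := β) h.log_two_le h.two_le hξ hα
      hdeg hord (fun n => h.approxDen_ne_zero (hq n)) (fun n => h.hasRate_approxDen (hq n))
      (fun n => h.hasRate_error (p := p n) hirr (hq n))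
      (fun n => h.eventually_le_log_den (hq n) (hpq n)) (N₀ := N₀) (fun n hn => ?_)
      (by linarith) (by linarith))
    have hdegn := natDegree_map_eq_of_injective (f := Int.castRingHom ℚ) Int.cast_injective (q n)
    have := hN₀ _ _ ((Polynomial.map_ne_zero_iff Int.cast_injective).2 (hq n)) (hpq n)
      (by rwa [hdegn])
    rwa [hdegn] at this
  · by_contra hcon
    rw [not_le] at hcon
    obtain ⟨x, hx1, hx2⟩ := EReal.lt_iff_exists_real_btwn.1 hcon
    rw [EReal.coe_lt_coe_iff] at hx2
    push_cast at hx2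
    have hx3 : (2 : ℝ) < x :=
      EReal.coe_lt_coe_iff.1 ((two_le_irrationalityExponent hξ).trans_lt hx1)
    -- For `ρ = 1` the lower bound `2` is Dirichlet's theorem, already contained in `hx3`.
    rcases hlow with rfl | hlow
    · norm_num at hx2
      linarith
    -- Degrees from `N` on make the bounded contributions of `α` and `β` smaller than the slack `1 +
    -- ρ - x`.
    obtain ⟨N, hN0, hN⟩ : ∃ N : ℕ, (0 : ℝ) < N ∧ (x - 1) * β + α < (1 + ρ - x) / 2 * N := by
      have h1 : Tendsto (fun N : ℕ => (1 + ρ - x) / 2 * (N : ℝ)) atTop atTop :=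
        tendsto_natCast_atTop_atTop.const_mul_atTop (by linarith)
      exact (((tendsto_natCast_atTop_atTop (R := ℝ)).eventually_gt_atTop 0).and
        (h1.eventually_gt_atTop _)).exists
    obtain ⟨p₀, q₀, hq₀, hpq₀, hND, hE⟩ := hlow ((1 + ρ - x) / 2) (by linarith) N
    obtain ⟨p, q, hq, hpq, hdeg, hord⟩ := exists_int_pair hirr hq₀ hpq₀
    rw [← hdeg, ← hord] at hE
    rw [← hdeg] at hND
    have hNDR : (N : ℝ) ≤ q.natDegree := by exact_mod_cast hND
    have hD := h.hasRate_approxDen hq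
    have hErr := h.hasRate_error (p := p) hirr hq
    rw [neg_add_eq_sub, ← neg_sub _ α] at hErr
    refine absurd (le_irrationalityExponent (infinite_approxSet (μ := x) h.log_pos h.two_le hξ
      ?_ (by linarith) ?_ hD hErr)) (not_le.2 hx1)
    · linarith
    · change x * (q.natDegree + β) < q.natDegree + β + (_ - α)
      have h1 := mul_le_mul_of_nonneg_left hNDR (by linarith : 0 ≤ (1 + ρ - x) / 2)
      linarith

/-- A rational function takes rational values at rational points of convergence. -/
theorem notRational_of_irrational {f : SeriesAtInfinity} {b : ℤ} {v : ℝ} (hb : b ≠ 0)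
    (hv : HasVal f b v) (hirr : Irrational v) : NotRational f := by
  intro p q hq h
  have hb' : (b : ℝ) ≠ 0 := by exact_mod_cast hb
  have hg : gcd p q ≠ 0 := fun h => hq ((gcd_eq_zero_iff _ _).1 h).2
  -- After reduction `q'` cannot vanish at `b`, since `p'` would vanish there too.
  obtain ⟨p', q', hp', hq', hu⟩ := extract_gcd p q
  have hcop := (gcd_isUnit_iff _ _).1 hu
  have h' : ofPoly q' * f = ofPoly p' := by
    apply mul_left_cancel₀ (ofPoly_ne_zero hg)
    rw [← mul_assoc, ← ofPoly_mul, ← ofPoly_mul, ← hp', ← hq', h]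
  have hval := (hv.polynomial_mul hb' q').unique (h' ▸ HasVal.polynomial hb' p')
  have hcast : ∀ r : ℚ[X], aeval (b : ℝ) r = ((r.eval (b : ℚ) : ℚ) : ℝ) := by
    intro r
    have := aeval_algebraMap_apply ℝ (b : ℚ) r
    simpa using this
  rw [hcast, hcast] at hval
  have hq0 : q'.eval (b : ℚ) ≠ 0 := by
    intro h0
    rw [h0, Rat.cast_zero, zero_mul] at hval
    have hp0 : p'.eval (b : ℚ) = 0 := by exact_mod_cast hval.symm
    obtain ⟨u, w, huw⟩ := hcop
    have := congrArg (eval (b : ℚ)) huw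
    simp [h0, hp0] at this
  have hq0' : ((q'.eval (b : ℚ) : ℚ) : ℝ) ≠ 0 := by exact_mod_cast hq0
  apply hirr.ne_rat (p'.eval (b : ℚ) / q'.eval (b : ℚ))
  push_cast
  rw [eq_div_iff hq0', mul_comm]
  exact hval

end Mahler

end

/-! ### Reduction of the theorem to integer coefficients and `2 ≤ |b|` -/

theorem theorem1 (d : ℕ) (hd : 2 ≤ d) (A B : Polynomial ℚ) (hB : B ≠ 0)
    (f : Mahler.SeriesAtInfinity)
    (hf : f = Mahler.ofPoly A / Mahler.ofPoly B *
      Mahler.substPow d (lt_of_lt_of_le Nat.zero_lt_two hd) f)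
    (b : ℤ) (hb : (b : ℂ) ∈ Mahler.convergenceDisc f)
    (hAB : ∀ m : ℕ, A.eval ((b : ℚ) ^ d ^ m) * B.eval ((b : ℚ) ^ d ^ m) ≠ 0)
    (hirr : Irrational (Mahler.value f (b : ℝ))) :
    ∃ ρ : ℚ, Mahler.irrationalityExponent (Mahler.value f (b : ℝ)) = ((ρ : ℝ) : EReal) := by
  open Mahler in
  have hd0 : 0 < d := lt_of_lt_of_le Nat.zero_lt_two hd
  obtain ⟨r, hr, hrb, hs⟩ := hb
  rw [Complex.norm_intCast] at hrb
  have hb0 : b ≠ 0 := by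
    rintro rfl
    simp at hrb
    linarith
  obtain ⟨v, hv⟩ : ∃ v, HasVal f r v := by
    refine (Summable.of_abs (hs.congr fun n => ?_) :
      Summable fun n : ℤ => (f.coeff n : ℝ) * r ^ (-n))
    rw [abs_mul, abs_of_pos (zpow_pos hr _)]
  have hb1 : 1 ≤ |(b : ℝ)| := by exact_mod_cast Int.one_le_abs hb0
  have hval : ∀ m : ℕ, ∃ w, HasVal f ((b ^ d ^ m : ℤ) : ℝ) w := fun m => by
    refine hv.exists_of_le hr ?_
    push_cast
    rw [abs_pow]
    exact hrb.le.trans (le_self_pow₀ hb1 (by positivity))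
  choose F hF using hval
  have hF0 : HasVal f b (F 0) := by simpa using hF 0
  rw [hF0.value_eq] at hirr ⊢
  have hnr := notRational_of_irrational hb0 hF0 hirr
  obtain ⟨a, ha, A', hA'⟩ := exists_int_map A
  obtain ⟨e, he, B', hB'⟩ := exists_int_map B
  -- The factors that clear denominators are crossed over, so that the quotient `A / B` is
  -- unchanged.
  have hf' : ofPoly ((Polynomial.C a * B').map (Int.castRingHom ℚ)) * f =
      ofPoly ((Polynomial.C e * A').map (Int.castRingHom ℚ)) * substPow d hd0 f := by
    have h1 : ofPoly B * f = ofPoly A * substPow d hd0 f := by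
      have hB0 := ofPoly_ne_zero hB
      conv_lhs => rw [hf]
      field_simp
    rw [Polynomial.map_mul, Polynomial.map_mul, hA', hB', Polynomial.map_C, Polynomial.map_C,
      ofPoly_mul, ofPoly_mul, ofPoly_mul, ofPoly_mul]
    simp only [Int.coe_castRingHom]
    linear_combination (ofPoly (Polynomial.C (a : ℚ)) * ofPoly (Polynomial.C (e : ℚ))) * h1
  have heval : ∀ (c k : ℤ) (P : Polynomial ℚ) (P' : Polynomial ℤ), c ≠ 0 → k ≠ 0 →
      P'.map (Int.castRingHom ℚ) = Polynomial.C (c : ℚ) * P → ∀ m : ℕ,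
      P.eval ((b : ℚ) ^ d ^ m) ≠ 0 → (Polynomial.C k * P').eval (b ^ d ^ m) ≠ 0 := by
    intro c k P P' hc hk hP m hne h0
    have h1 := congrArg (Polynomial.eval ((b ^ d ^ m : ℤ) : ℚ)) hP
    rw [Polynomial.eval_intCast_map, Int.cast_id] at h1
    rw [Polynomial.eval_mul, Polynomial.eval_C] at h0
    rw [(mul_eq_zero.1 h0).resolve_left hk] at h1
    push_cast at h1
    simp [hc, hne] at h1
  have hAne := fun m => heval a e A A' ha he hA' m (left_ne_zero_of_mul (hAB m))
  have hBne := fun m => heval e a B B' he ha hB' m (right_ne_zero_of_mul (hAB m))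
  have hne : ∀ {P : Polynomial ℤ}, P.eval (b ^ d ^ 0) ≠ 0 → P ≠ 0 := by
    rintro P hP rfl
    simp at hP
  -- If `|b| = 1`, then `r < 1`, so `f` would be rational, contradicting `hnr`.
  have hb2 : 2 ≤ |b| := by
    by_contra hlt
    have h1 : |b| = 1 := le_antisymm (by omega) (Int.one_le_abs hb0)
    have h2 : |(b : ℝ)| = 1 := by exact_mod_cast h1
    obtain ⟨q, p, hq, hqp⟩ := exists_mul_eq_ofPoly_of_decays hd0 hd hf' (hne (hAne 0))
      (hne (hBne 0)) hr (h2 ▸ hrb) (Decays.of_summable hr hs)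
    exact hnr p q hq hqp
  refine Evaluation.exists_rat_irrationalityExponent (A := Polynomial.C e * A')
    (B := Polynomial.C a * B') ⟨hd, hb2, hAne, hBne, ⟨r, v, hr, hrb.le, hv⟩, hF, fun m => ?_⟩ hd0
    hf' hnr hirr
  have hx : ((b ^ d ^ m : ℤ) : ℝ) ≠ 0 := by exact_mod_cast pow_ne_zero _ hb0
  have h1 := (hF m).polynomial_mul hx ((Polynomial.C a * B').map (Int.castRingHom ℚ))
  have h2 : HasVal f (((b ^ d ^ m : ℤ) : ℝ) ^ d) (F (m + 1)) := by
    have := hF (m + 1)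
    push_cast at this ⊢
    rwa [pow_succ, pow_mul] at this
  have h3 := (h2.subst hd0).polynomial_mul hx ((Polynomial.C e * A').map (Int.castRingHom ℚ))
  rw [hf'] at h1
  have := h1.unique h3
  rwa [aeval_map_intCast, aeval_map_intCast] at this
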